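/- **Proposition ($n$-shot achievability of quantum soft covering with a random i.i.d. codebook).** Let $\mathcal X$ be a finite alphabet, $p_X$ a probability distribution on $\mathcal X$, and $(\rho_B^x)_{x\in\mathcal X}$ density operators on a finite-dimensional complex Hilbert space $\mathcal H_B$. Put $\rho_{XB}=\sum_{x}p_X(x)\,|x\rangle\langle x|\otimes\rho_B^x$, $\rho_X=\sum_x p_X(x)|x\rangle\langle x|$ (also written $p_X$) and $\rho_B=\sum_x p_X(x)\rho_B^x$. All logarithms are natural. For a density operator $\rho$ and a positive semidefinite $\sigma$ with $\operatorname{supp}\rho\subseteq\operatorname{supp}\sigma$ let $$D(\rho\|\sigma)=\operatorname{Tr}[\rho(\log\rho-\log\sigma)],\qquad D^*_\alpha(\rho\|\sigma)=\frac1{\alpha-1}\log\Big\|\sigma^{\frac{1-\alpha}{2\alpha}}\rho\,\sigma^{\frac{1-\alpha}{2\alpha}}\Big\|_\alpha^\alpha\quad(\alpha>1),$$ where $\|A\|_\alpha=(\operatorname{Tr}|A|^\alpha)^{1/\alpha}$ and logarithms and negative powers are taken on the support; both quantities are $+\infty$ if $\operatorname{supp}\rho\not\subseteq\operatorname{supp}\sigma$.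 Let $$I^*_\alpha(X{:}B)_\rho=\inf_{\sigma_B}D^*_\alpha(\rho_{XB}\|p_X\otimes\sigma_B),\qquad I(X{:}B)_\rho=D(\rho_{XB}\|\rho_X\otimes\rho_B),$$ the infimum being over all density operators $\sigma_B$ on $\mathcal H_B$, and for $R\in\mathbb R$ let $$\mathsf E^*(R)=\sup_{\alpha\in(1,2)}\frac{1-\alpha}{\alpha}\big(I^*_\alpha(X{:}B)_\rho-R\big).$$ For integers $n,M\ge1$ let $\mathcal C^n=(x^n(1),\dots,x^n(M))$ be a random codebook whose $M$ codewords are drawn independently from $p_X^{\otimes n}$ on $\mathcal X^n$ (repetitions being counted with multiplicity), let $R=\frac1n\log M$, and let $$\rho_{B^n}^{\mathcal C^n}=\frac1M\sum_{m=1}^M\rho_{B^n}^{x^n(m)},\qquad \rho_{B^n}^{x^n}=\rho_B^{x_1}\otimes\cdots\otimes\rho_B^{x_n}.$$ Then $$\frac12\,\mathbb E_{\mathcal C^n}\big\|\rho_{B^n}^{\mathcal C^n}-\rho_B^{\otimes n}\big\|_1\le e^{-n\,\mathsf E^*(R)} .$$ Moreover, for every $R\in\mathbb R$, one has $\mathsf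 E^*(R)>0$ if and only if $R>I(X{:}B)_\rho$. -/

import Mathlib

open scoped Matrix Kronecker ComplexOrder

noncomputable section

namespace SoftCovering

/-! Operators on a finite-dimensional Hilbert space are complex matrices indexed by an orthonormal
basis. All logarithms are natural. -/

section Operators

variable {d : Type*} [Fintype d] [DecidableEq d]

/-- Density operators: positive semidefinite with unit trace. -/
def IsDensity (ρ : Matrix d d ℂ) : Prop := ρ.PosSemidef ∧ ρ.trace = 1

/-- The real power `A ^ s` of a positive semidefinite operator, by functional calculus. For `s ≠ 0`
the zero eigenvalue is sent to `0`, so that negative powers are taken on the support. -/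
def power (A : Matrix d d ℂ) (s : ℝ) : Matrix d d ℂ := cfc (fun t : ℝ => t ^ s) A

/-- The logarithm of a positive semidefinite operator, taken on its support. -/
def logarithm (A : Matrix d d ℂ) : Matrix d d ℂ := cfc Real.log A

/-- The absolute value `|A| = (A† A) ^ (1 / 2)`. -/
def absolute (A : Matrix d d ℂ) : Matrix d d ℂ := cfc Real.sqrt (Aᴴ * A)

/-- The Schatten norm `‖A‖_q = (Tr |A| ^ q) ^ (1 / q)`. -/
def schattenNorm (q : ℝ) (A : Matrix d d ℂ) : ℝ :=
  ((power (absolute A) q).trace.re) ^ (1 / q)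

/-- `supp ρ ⊆ supp σ`, i.e. `ker σ ⊆ ker ρ`, for positive semidefinite `ρ` and `σ`. -/
def SuppLE (ρ σ : Matrix d d ℂ) : Prop := ∀ v : d → ℂ, σ *ᵥ v = 0 → ρ *ᵥ v = 0

/-- `‖σ ^ ((1 - α) / (2 α)) ρ σ ^ ((1 - α) / (2 α))‖_α ^ α`. -/
def sandwichedQ (α : ℝ) (ρ σ : Matrix d d ℂ) : ℝ :=
  schattenNorm α (power σ ((1 - α) / (2 * α)) * ρ * power σ ((1 - α) / (2 * α))) ^ α

open Classical in
/-- The sandwiched Rényi divergence of order `α ∈ (0, 1) ∪ (1, ∞)`,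
`D*_α(ρ‖σ) = 1 / (α - 1) * log ‖σ ^ ((1 - α) / (2 α)) ρ σ ^ ((1 - α) / (2 α))‖_α ^ α`.
It is `+∞` if `α > 1` and the support of `ρ` is not contained in that of `σ`, and if `α < 1` and
`ρ` and `σ` are orthogonal (the logarithm is then `-∞`). -/
def sandwichedRenyiDiv (α : ℝ) (ρ σ : Matrix d d ℂ) : EReal :=
  if (1 < α ∧ ¬ SuppLE ρ σ) ∨ (α < 1 ∧ sandwichedQ α ρ σ = 0) then ⊤
  else ((1 / (α - 1) * Real.log (sandwichedQ α ρ σ) : ℝ) : EReal)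

open Classical in
/-- The quantum relative entropy `D(ρ‖σ) = Tr[ρ (log ρ - log σ)]`, which is `+∞` if the support of
`ρ` is not contained in that of `σ`. -/
def relativeEntropy (ρ σ : Matrix d d ℂ) : EReal :=
  if SuppLE ρ σ then (((ρ * (logarithm ρ - logarithm σ)).trace.re : ℝ) : EReal) else ⊤

/-- The tensor product `A 0 ⊗ ⋯ ⊗ A (n - 1)`, in the product basis. -/
def tensor {n : ℕ} (A : Fin n → Matrix d d ℂ) : Matrix (Fin n → d) (Fin n → d) ℂ :=
  Matrix.of fun f g => ∏ i, A i (f i) (g i)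

end Operators

section ClassicalQuantum

variable {X d : Type*} [Fintype X] [DecidableEq X] [Fintype d] [DecidableEq d]

/-- The classical state `∑ x, p(x) |x⟩⟨x|`. -/
def classicalState (p : X → ℝ) : Matrix X X ℂ :=
  ∑ x, (p x : ℂ) • Matrix.single x x (1 : ℂ)

/-- The classical-quantum state `ρ_XB = ∑ x, p(x) |x⟩⟨x| ⊗ ρ x`. -/
def cqState (p : X → ℝ) (ρ : X → Matrix d d ℂ) : Matrix (X × d) (X × d) ℂ :=
  ∑ x, (p x : ℂ) • (Matrix.single x x (1 : ℂ) ⊗ₖ ρ x)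

/-- The marginal (channel output) state `ρ_B = ∑ x, p(x) ρ x`. -/
def outputState (p : X → ℝ) (ρ : X → Matrix d d ℂ) : Matrix d d ℂ :=
  ∑ x, (p x : ℂ) • ρ x

/-- The sandwiched Rényi information `I*_α(X:B) = inf_σ D*_α(ρ_XB ‖ p_X ⊗ σ)` over density
operators `σ` on `B`. -/
def sandwichedRenyiInfo (α : ℝ) (p : X → ℝ) (ρ : X → Matrix d d ℂ) : EReal :=
  ⨅ (σ : Matrix d d ℂ) (_ : IsDensity σ),
    sandwichedRenyiDiv α (cqState p ρ) (classicalState p ⊗ₖ σ)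

/-- The quantum mutual information `I(X:B) = D(ρ_XB ‖ ρ_X ⊗ ρ_B)`. -/
def mutualInfo (p : X → ℝ) (ρ : X → Matrix d d ℂ) : EReal :=
  relativeEntropy (cqState p ρ) (classicalState p ⊗ₖ outputState p ρ)

/-- The exponent `sup_{α ∈ (1,2)} (1 - α) / α * (I*_α(X:B) - R)`. -/
def coveringExponent (p : X → ℝ) (ρ : X → Matrix d d ℂ) (R : ℝ) : EReal :=
  ⨆ α ∈ Set.Ioo (1 : ℝ) 2,
    (((1 - α) / α : ℝ) : EReal) * (sandwichedRenyiInfo α p ρ - (R : EReal))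

/-- The state `(1 / M) ∑ m, ρ (x(m))` induced by a codebook `x(1), …, x(M)`. -/
def codebookState {M : ℕ} (ρ : X → Matrix d d ℂ) (c : Fin M → X) : Matrix d d ℂ :=
  (1 / (M : ℂ)) • ∑ m, ρ (c m)

/-- The expected trace distance `(1 / 2) E_C ‖ρ^C - ω‖_1` for a codebook `C` of `M` codewords drawn
independently from `p`. -/
def expectedTraceDistance (M : ℕ) (p : X → ℝ) (ρ : X → Matrix d d ℂ) (ω : Matrix d d ℂ) : ℝ :=
  1 / 2 * ∑ c : Fin M → X, (∏ m, p (c m)) * schattenNorm 1 (codebookState ρ c - ω)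

/-- The product distribution `p^{⊗ n}` on words of length `n`. -/
def productDist (n : ℕ) (p : X → ℝ) : (Fin n → X) → ℝ := fun x => ∏ i, p (x i)

/-- The `n`-fold product channel `x^n ↦ ρ (x_1) ⊗ ⋯ ⊗ ρ (x_n)`. -/
def productChannel (n : ℕ) (ρ : X → Matrix d d ℂ) :
    (Fin n → X) → Matrix (Fin n → d) (Fin n → d) ℂ :=
  fun x => tensor fun i => ρ (x i)

end ClassicalQuantum

end SoftCovering

end

open scoped Matrix Kronecker ComplexOrder

set_option linter.unusedSectionVars false

noncomputable section

namespace SoftCovering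

/-! ### Functional calculus through explicit diagonalizations -/

section FunctionalCalculus

variable {d e : Type*} [Fintype d] [DecidableEq d] [Fintype e] [DecidableEq e]

/-! Achievability is proved for one order `α ∈ (1, 2)` and one reference density operator `σ` at a
time. Hölder's inequality, paired with `Tr σ = 1`, bounds the trace norm of the deviation `Y` by the
Schatten `α`-norm of `σ ^ (-r) Y σ ^ (-r)`, `r = (α - 1) / (2 α)` (`schattenNorm_one_le`). After
this conjugation `Y` is `1 / M` times a sum of `M` i.i.d. centred Hermitian matrices. Since `α ≤ 2`,
the `α`-moment of such a sum grows only linearly in `M` (`sum_prod_absMoment_le`), by symmetrization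
and the two-point Clarkson inequality (`absMoment_add_add_sub_le`). Concavity of `t ↦ t ^ (1 / α)`
then gives `(M ^ (1 - α) Q) ^ (1 / α)`, the factor 2 lost in symmetrization being cancelled by the
`1 / 2` of the trace distance. Here `Q` is the sandwiched quantity of `ρ_XB` relative to `p_X ⊗ σ`
(`sandwichedQ_cqState`). With `σ ^ {⊗ n}` as reference, `Q` becomes `Q ^ n`; the infimum over `σ`
and the supremum over `α` give the exponent.

The prefactor `(1 - α) / α` is negative, so the exponent is positive exactly when some `I*_α` lies
below `R`. For `α > 1` the sandwiched divergence dominates the relative entropy (Hölder against a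
power of `ρ`, then Jensen for `exp`), and among all `σ` the marginal `ρ_B` minimizes `D(ρ_XB ‖ p_X ⊗
σ)`; hence `I*_α ≥ I`. Conversely, with `σ = ρ_B`, Löwner–Heinz bounds `Q` by an explicit function
of `α` whose logarithm vanishes at `α = 1` with derivative `I` (`sandwichedQ_le`,
`exists_sandwichedQ_lt`), so `I < R` forces `I*_α < R` for some `α` near 1.

Trace inequalities are reduced to scalar ones through the doubly stochastic matrix of squared
overlaps of two eigenbases. -/

theorem finite_spectrum_real {A : Matrix d d ℂ} (hA : A.IsHermitian) : (spectrum ℝ A).Finite := by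
  rw [hA.spectrum_real_eq_range_eigenvalues]
  exact Set.finite_range _

/-- Lagrange interpolation. Since spectra are finite, every function is a polynomial as far as the
calculus is concerned, so no continuity is ever needed, even for negative powers or `log` at `0`. -/
theorem exists_polynomial_eqOn {s : Set ℝ} (hs : s.Finite) (f : ℝ → ℝ) :
    ∃ q : Polynomial ℝ, ∀ x ∈ s, q.eval x = f x := by
  refine ⟨Lagrange.interpolate hs.toFinset id f, fun x hx => ?_⟩
  have h := Lagrange.eval_interpolate_at_node (s := hs.toFinset) (v := id) f
    (Function.injective_id.injOn) (hs.mem_toFinset.2 hx)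
  simpa using h

theorem cfc_eq_aeval {A : Matrix d d ℂ} (hA : A.IsHermitian) {f : ℝ → ℝ} {q : Polynomial ℝ}
    (hq : ∀ x ∈ spectrum ℝ A, q.eval x = f x) : cfc f A = Polynomial.aeval A q := by
  rw [← cfc_polynomial q A hA.isSelfAdjoint]
  exact cfc_congr fun x hx => (hq x hx).symm

theorem aeval_mul_intertwine {A : Matrix d d ℂ} {B : Matrix e e ℂ} {X : Matrix d e ℂ}
    (h : A * X = X * B) (q : Polynomial ℝ) :
    Polynomial.aeval A q * X = X * Polynomial.aeval B q := by
  induction q using Polynomial.induction_on' with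
  | add p q hp hq => simp [Matrix.add_mul, Matrix.mul_add, hp, hq]
  | monomial n c =>
    simp only [Polynomial.aeval_monomial, Algebra.algebraMap_eq_smul_one, smul_mul_assoc, one_mul,
      Matrix.smul_mul, Matrix.mul_smul]
    congr 1
    induction n with
    | zero => simp
    | succ n ih => rw [pow_succ, Matrix.mul_assoc, h, ← Matrix.mul_assoc, ih, Matrix.mul_assoc,
        ← pow_succ]

/-- The functional calculus respects intertwiners. -/
theorem cfc_mul_intertwine {A : Matrix d d ℂ} {B : Matrix e e ℂ} {X : Matrix d e ℂ}
    (hA : A.IsHermitian) (hB : B.IsHermitian) (h : A * X = X * B) (f : ℝ → ℝ) :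
    cfc f A * X = X * cfc f B := by
  obtain ⟨q, hq⟩ := exists_polynomial_eqOn ((finite_spectrum_real hA).union
    (finite_spectrum_real hB)) f
  rw [cfc_eq_aeval hA fun x hx => hq x (Or.inl hx), cfc_eq_aeval hB fun x hx => hq x (Or.inr hx),
    aeval_mul_intertwine h]

theorem isHermitian_diagonal_ofReal {d : Type*} [DecidableEq d] (a : d → ℝ) :
    (Matrix.diagonal fun i => (a i : ℂ)).IsHermitian := by
  simp [Matrix.isHermitian_diagonal_iff, isSelfAdjoint_iff]

theorem cfc_diagonal (a : d → ℝ) (f : ℝ → ℝ) :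
    cfc f (Matrix.diagonal fun i => (a i : ℂ)) = Matrix.diagonal fun i => ((f (a i) : ℝ) : ℂ) := by
  have hA := isHermitian_diagonal_ofReal a
  obtain ⟨q, hq⟩ := exists_polynomial_eqOn ((finite_spectrum_real hA).union
    (Set.finite_range a)) f
  rw [cfc_eq_aeval hA fun x hx => hq x (Or.inl hx)]
  have : (Matrix.diagonal fun i => (a i : ℂ)) =
      Matrix.diagonalAlgHom ℝ (fun i => (a i : ℂ)) := rfl
  rw [this, Polynomial.aeval_algHom_apply, Matrix.diagonalAlgHom_apply]
  congr 1
  ext i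
  rw [← hq (a i) (Or.inr ⟨i, rfl⟩)]
  refine (Polynomial.aeval_algHom_apply (Pi.evalAlgHom ℝ (fun _ : d => ℂ) i) _ q).symm.trans ?_
  exact (Polynomial.aeval_algebraMap_apply_eq_algebraMap_eval (a i) q)

/-- `U` is a unitary diagonalizing `A`, with the real eigenvalues `a`. -/
structure Diagonalizes (U : Matrix d d ℂ) (a : d → ℝ) (A : Matrix d d ℂ) : Prop where
  left_inv : Uᴴ * U = 1
  eq : A = U * Matrix.diagonal (fun i => (a i : ℂ)) * Uᴴ

namespace Diagonalizes

variable {U A : Matrix d d ℂ} {a : d → ℝ}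

theorem right_inv (h : Diagonalizes U a A) : U * Uᴴ = 1 := mul_eq_one_comm.1 h.left_inv

theorem isHermitian (h : Diagonalizes U a A) : A.IsHermitian := by
  rw [h.eq]
  exact Matrix.isHermitian_mul_mul_conjTranspose _ (isHermitian_diagonal_ofReal a)

theorem map (h : Diagonalizes U a A) (f : ℝ → ℝ) : Diagonalizes U (fun i => f (a i)) (cfc f A) := by
  refine ⟨h.left_inv, ?_⟩
  have h1 : A * U = U * Matrix.diagonal (fun i => (a i : ℂ)) := by
    conv_lhs => rw [h.eq, Matrix.mul_assoc, h.left_inv, Matrix.mul_one]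
  have h2 := cfc_mul_intertwine h.isHermitian (isHermitian_diagonal_ofReal a) h1 f
  rw [cfc_diagonal] at h2
  rw [← h2, Matrix.mul_assoc, h.right_inv, Matrix.mul_one]

theorem trace_eq (h : Diagonalizes U a A) : A.trace = ((∑ i, a i : ℝ) : ℂ) := by
  rw [h.eq, Matrix.mul_assoc, Matrix.trace_mul_comm, Matrix.mul_assoc, h.left_inv, Matrix.mul_one,
    Matrix.trace_diagonal]
  push_cast
  rfl

theorem apply_eq (h : Diagonalizes U a A) (V : Matrix d d ℂ) (i : d) :
    (Vᴴ * A * V) i i = ((∑ j, ‖(Vᴴ * U) i j‖ ^ 2 * a j : ℝ) : ℂ) := by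
  have : Vᴴ * A * V = (Vᴴ * U) * Matrix.diagonal (fun i => (a i : ℂ)) * (Vᴴ * U)ᴴ := by
    rw [h.eq]; simp [Matrix.mul_assoc]
  rw [this, Matrix.mul_apply]
  push_cast
  refine Finset.sum_congr rfl fun j _ => ?_
  rw [Matrix.mul_diagonal, Matrix.conjTranspose_apply, mul_right_comm, RCLike.star_def,
    Complex.mul_conj, Complex.normSq_eq_norm_sq]
  push_cast
  rfl

theorem conjTranspose_mul_mul (h : Diagonalizes U a A) :
    Uᴴ * A * U = Matrix.diagonal (fun i => (a i : ℂ)) := by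
  rw [h.eq]
  calc _ = (Uᴴ * U) * Matrix.diagonal (fun i => (a i : ℂ)) * (Uᴴ * U) := by
        simp only [Matrix.mul_assoc]
    _ = _ := by simp [h.left_inv]

theorem nonneg (h : Diagonalizes U a A) (hA : A.PosSemidef) (i : d) : 0 ≤ a i := by
  have h1 := hA.conjTranspose_mul_mul_same U
  rw [h.conjTranspose_mul_mul, Matrix.posSemidef_diagonal_iff] at h1
  exact_mod_cast h1 i

theorem posSemidef (h : Diagonalizes U a A) (ha : ∀ i, 0 ≤ a i) : A.PosSemidef := by
  rw [h.eq]
  refine Matrix.PosSemidef.mul_mul_conjTranspose_same ?_ U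
  rw [Matrix.posSemidef_diagonal_iff]
  exact fun i => by exact_mod_cast ha i

theorem mul (h : Diagonalizes U a A) {B : Matrix d d ℂ} {b : d → ℝ} (h' : Diagonalizes U b B) :
    Diagonalizes U (fun i => a i * b i) (A * B) := by
  refine ⟨h.left_inv, ?_⟩
  rw [h.eq, h'.eq]
  calc _ = U * Matrix.diagonal (fun i => (a i : ℂ)) * (Uᴴ * U) * Matrix.diagonal (fun i => (b i : ℂ)) * Uᴴ := by
          simp only [Matrix.mul_assoc]
      _ = _ := by simp [h.left_inv, Matrix.mul_assoc]

theorem unique (h : Diagonalizes U a A) {B : Matrix d d ℂ} (h' : Diagonalizes U a B) : A = B := by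
  rw [h.eq, h'.eq]

end Diagonalizes

theorem exists_diagonalizes {A : Matrix d d ℂ} (hA : A.IsHermitian) :
    ∃ U a, Diagonalizes U a A := by
  refine ⟨hA.eigenvectorUnitary, hA.eigenvalues, ?_, ?_⟩
  · exact Unitary.coe_star_mul_self hA.eigenvectorUnitary
  · exact hA.spectral_theorem

/-- At a zero eigenvalue the right side is `0` whatever the quotient is, which is why `f 0 = 0` is
required. -/
theorem cfc_eq_mul_cfc_div {A : Matrix d d ℂ} (hA : A.IsHermitian) {f : ℝ → ℝ} (hf : f 0 = 0) :
    cfc f A = A * cfc (fun t => f t / t) A := by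
  obtain ⟨U, a, h⟩ := exists_diagonalizes hA
  refine (h.map f).unique ?_
  convert h.mul (h.map fun t => f t / t) using 2 with i
  by_cases h0 : a i = 0
  · simp [h0, hf]
  · field_simp

end FunctionalCalculus

/-! ### Overlaps of two orthonormal bases -/

section Overlap

variable {d : Type*} [Fintype d]

/-- The squared overlaps of two orthonormal bases. -/
def overlap (U V : Matrix d d ℂ) (i j : d) : ℝ := ‖(Uᴴ * V) i j‖ ^ 2

theorem overlap_nonneg (U V : Matrix d d ℂ) (i j : d) : 0 ≤ overlap U V i j := sq_nonneg _

theorem overlap_comm (U V : Matrix d d ℂ) (i j : d) : overlap U V i j = overlap V U j i := by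
  have : (Uᴴ * V) i j = star ((Vᴴ * U) j i) := by
    rw [← Matrix.conjTranspose_apply]
    simp only [Matrix.conjTranspose_mul, Matrix.conjTranspose_conjTranspose]
  rw [overlap, overlap, this, norm_star]

end Overlap

/-! ### Convexity and concavity under the trace -/

section TraceInequalities

variable {d e : Type*} [Fintype d] [DecidableEq d] [Fintype e] [DecidableEq e]

theorem diagonalizes_one {U : Matrix d d ℂ} (hU : Uᴴ * U = 1) :
    Diagonalizes U (fun _ => 1) 1 :=
  ⟨hU, by simp [mul_eq_one_comm.1 hU]⟩

theorem sum_overlap_right {U V : Matrix d d ℂ} (hU : Uᴴ * U = 1) (hV : Vᴴ * V = 1) (i : d) :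
    ∑ j, overlap U V i j = 1 := by
  have h := (diagonalizes_one hV).apply_eq U i
  rw [Matrix.mul_one, hU, Matrix.one_apply_eq] at h
  simp only [mul_one] at h
  exact_mod_cast h.symm

theorem sum_overlap_left {U V : Matrix d d ℂ} (hU : Uᴴ * U = 1) (hV : Vᴴ * V = 1) (j : d) :
    ∑ i, overlap U V i j = 1 := by
  simp_rw [overlap_comm U V]
  exact sum_overlap_right hV hU j

theorem Diagonalizes.trace_mul {U V A B : Matrix d d ℂ} {a b : d → ℝ} (hA : Diagonalizes U a A)
    (hB : Diagonalizes V b B) :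
    (A * B).trace = ((∑ i, ∑ j, overlap U V i j * a i * b j : ℝ) : ℂ) := by
  have h1 : (A * B).trace = (Matrix.diagonal (fun i => (a i : ℂ)) * (Uᴴ * B * U)).trace := by
    rw [hA.eq, Matrix.mul_assoc, Matrix.mul_assoc, Matrix.trace_mul_comm]
    simp only [Matrix.mul_assoc]
  rw [h1, Matrix.trace]
  push_cast
  refine Finset.sum_congr rfl fun i _ => ?_
  rw [Matrix.diag_apply, Matrix.diagonal_mul, hB.apply_eq U i]
  push_cast
  rw [Finset.mul_sum]
  refine Finset.sum_congr rfl fun j _ => ?_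
  simp only [overlap]
  push_cast
  ring

/-- Peierls' inequality. -/
theorem Diagonalizes.sum_map_diag_le {U V A : Matrix d d ℂ} {a : d → ℝ} {s : Set ℝ} {f : ℝ → ℝ}
    (hA : Diagonalizes U a A) (hf : ConvexOn ℝ s f) (has : ∀ i, a i ∈ s) (hV : Vᴴ * V = 1) :
    ∑ i, f ((Vᴴ * A * V) i i).re ≤ (cfc f A).trace.re := by
  rw [(hA.map f).trace_eq, Complex.ofReal_re]
  -- Each diagonal entry is an average of eigenvalues with weights a row of the overlap matrix;
  -- after scalar Jensen, the column sums `1` remove the weights.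
  calc ∑ i, f ((Vᴴ * A * V) i i).re ≤ ∑ i, ∑ j, overlap V U i j * f (a j) := by
        refine Finset.sum_le_sum fun i _ => ?_
        rw [hA.apply_eq V i, Complex.ofReal_re]
        exact hf.map_sum_le (fun j _ => overlap_nonneg V U i j)
          (sum_overlap_right hV hA.left_inv i) (fun j _ => has j)
    _ = _ := by
        rw [Finset.sum_comm]
        refine Finset.sum_congr rfl fun j _ => ?_
        rw [← Finset.sum_mul, sum_overlap_left hV hA.left_inv, one_mul]

/-- Jensen's trace inequality for mixtures. -/
theorem trace_cfc_sum_le {ι : Type*} (t : Finset ι) {s : Set ℝ} {f : ℝ → ℝ}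
    (hf : ConvexOn ℝ s f) (p : ι → ℝ) (hp : ∀ k ∈ t, 0 ≤ p k) (hp1 : ∑ k ∈ t, p k = 1)
    (A : ι → Matrix d d ℂ) (hA : ∀ k ∈ t, (A k).IsHermitian)
    (hs : ∀ k ∈ t, ∀ U a, Diagonalizes U a (A k) → ∀ i, a i ∈ s) :
    (cfc f (∑ k ∈ t, (p k : ℂ) • A k)).trace.re ≤ ∑ k ∈ t, p k * (cfc f (A k)).trace.re := by
  have hH : (∑ k ∈ t, (p k : ℂ) • A k).IsHermitian := by
    rw [Matrix.IsHermitian, Matrix.conjTranspose_sum]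
    refine Finset.sum_congr rfl fun k hk => ?_
    rw [Matrix.conjTranspose_smul, (hA k hk).eq, RCLike.star_def, Complex.conj_ofReal]
  obtain ⟨V, b, hV⟩ := exists_diagonalizes hH
  have hb : ∀ i, b i = ∑ k ∈ t, p k * ((Vᴴ * A k * V) i i).re := by
    intro i
    have h1 := hV.conjTranspose_mul_mul
    have h2 := congrArg (fun B => (B i i).re) h1
    simp only [Matrix.diagonal_apply_eq, Complex.ofReal_re] at h2
    rw [← h2, Matrix.mul_sum, Matrix.sum_mul, Matrix.sum_apply, Complex.re_sum]
    refine Finset.sum_congr rfl fun k _ => ?_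
    rw [Matrix.mul_smul, Matrix.smul_mul, Matrix.smul_apply, smul_eq_mul, Complex.re_ofReal_mul]
  rw [(hV.map f).trace_eq, Complex.ofReal_re]
  calc ∑ i, f (b i) ≤ ∑ i, ∑ k ∈ t, p k * f ((Vᴴ * A k * V) i i).re := by
        refine Finset.sum_le_sum fun i _ => ?_
        rw [hb i]
        refine hf.map_sum_le hp hp1 fun k hk => ?_
        obtain ⟨U, a, hU⟩ := exists_diagonalizes (hA k hk)
        rw [hU.apply_eq V i, Complex.ofReal_re]
        exact hf.1.sum_mem (fun j _ => overlap_nonneg V U i j)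
          (sum_overlap_right hV.left_inv hU.left_inv i) (fun j _ => hs k hk U a hU j)
    _ = ∑ k ∈ t, p k * ∑ i, f ((Vᴴ * A k * V) i i).re := by
        rw [Finset.sum_comm]
        simp_rw [Finset.mul_sum]
    _ ≤ _ := by
        refine Finset.sum_le_sum fun k hk => mul_le_mul_of_nonneg_left ?_ (hp k hk)
        obtain ⟨U, a, hU⟩ := exists_diagonalizes (hA k hk)
        exact hU.sum_map_diag_le hf (hs k hk U a hU) hV.left_inv

/-- `X` intertwines `X * Xᴴ` with `Xᴴ * X`; writing `f t = t * (f t / t)`, cyclicity of the trace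
does the rest. The kernels may differ in dimension, but `f 0 = 0` makes them invisible. -/
theorem trace_cfc_mul_conjTranspose (X : Matrix d e ℂ) {f : ℝ → ℝ} (hf : f 0 = 0) :
    (cfc f (X * Xᴴ)).trace = (cfc f (Xᴴ * X)).trace := by
  have hA : (X * Xᴴ).IsHermitian := Matrix.isHermitian_mul_conjTranspose_self X
  have hB : (Xᴴ * X).IsHermitian := Matrix.isHermitian_conjTranspose_mul_self X
  have hX : X * Xᴴ * X = X * (Xᴴ * X) := Matrix.mul_assoc _ _ _
  have h1 := cfc_mul_intertwine hA hB hX (fun t => f t / t)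
  rw [cfc_eq_mul_cfc_div hA hf, cfc_eq_mul_cfc_div hB hf, Matrix.trace_mul_comm, ← Matrix.mul_assoc, h1, Matrix.trace_mul_comm,
    Matrix.mul_assoc]

/-- Subadditivity of `A ↦ Tr f(A)` for concave `f` with `f 0 = 0`, on squares. -/
theorem trace_cfc_sq_add_sq_le {f : ℝ → ℝ} (hf : ConcaveOn ℝ (Set.Ici 0) f) (hf0 : f 0 = 0)
    {A B : Matrix d d ℂ} (hA : A.IsHermitian) (hB : B.IsHermitian) :
    (cfc f (A * A + B * B)).trace.re ≤ (cfc f (A * A)).trace.re + (cfc f (B * B)).trace.re := by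
  obtain ⟨U, a, hU⟩ := exists_diagonalizes hA
  obtain ⟨V, b, hV⟩ := exists_diagonalizes hB
  -- For the row `X = [A B]`, `X * Xᴴ` is the sum of squares while `Xᴴ * X` has `A * A` and `B * B`
  -- as diagonal blocks. Peierls' inequality for `-f`, in a basis diagonalizing both blocks,
  -- discards the off-diagonal blocks.
  set X : Matrix d (d ⊕ d) ℂ := Matrix.fromCols A B with hX
  have hXX : X * Xᴴ = A * A + B * B := by
    rw [hX, Matrix.conjTranspose_fromCols_eq_fromRows_conjTranspose, Matrix.fromCols_mul_fromRows,
      hA.eq, hB.eq]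
  rw [← hXX, trace_cfc_mul_conjTranspose X hf0]
  have hP : (Xᴴ * X).PosSemidef := Matrix.posSemidef_conjTranspose_mul_self X
  obtain ⟨Y, c, hY⟩ := exists_diagonalizes hP.isHermitian
  set W : Matrix (d ⊕ d) (d ⊕ d) ℂ := Matrix.fromBlocks U 0 0 V with hW
  have hWW : Wᴴ * W = 1 := by
    rw [hW, Matrix.fromBlocks_conjTranspose, Matrix.fromBlocks_multiply]
    simp [hU.left_inv, hV.left_inv]
  have h := hY.sum_map_diag_le hf.neg (fun i => hY.nonneg hP i) hWW
  have hXX' : Wᴴ * (Xᴴ * X) * W = Matrix.fromBlocks (Uᴴ * (A * A) * U) (Uᴴ * (A * B) * V)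
      (Vᴴ * (B * A) * U) (Vᴴ * (B * B) * V) := by
    rw [hX, Matrix.conjTranspose_fromCols_eq_fromRows_conjTranspose, Matrix.fromRows_mul_fromCols,
      hW, Matrix.fromBlocks_conjTranspose, Matrix.fromBlocks_multiply, Matrix.fromBlocks_multiply,
      hA.eq, hB.eq]
    simp
  rw [hXX', Fintype.sum_sum_type] at h
  simp only [Matrix.fromBlocks_apply₁₁, Matrix.fromBlocks_apply₂₂] at h
  have hdiag : ∀ {U A : Matrix d d ℂ} {a : d → ℝ}, Diagonalizes U a A → ∀ i,
      ((Uᴴ * A * U) i i).re = a i := by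
    intro U A a hU i
    rw [hU.conjTranspose_mul_mul, Matrix.diagonal_apply_eq, Complex.ofReal_re]
  simp only [hdiag (hU.mul hU), hdiag (hV.mul hV)] at h
  rw [((hU.mul hU).map f).trace_eq, ((hV.mul hV).map f).trace_eq]
  have h3 : (cfc (-f) (Xᴴ * X)).trace.re = -(cfc f (Xᴴ * X)).trace.re := by
    rw [(hY.map f).trace_eq, (hY.map (-f)).trace_eq]
    simp
  rw [h3] at h
  simp only [Pi.neg_apply, Finset.sum_neg_distrib, Complex.ofReal_re] at h ⊢
  linarith

end TraceInequalities

/-! ### Absolute moments: Clarkson, Hölder and domination -/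

section AbsMoment

variable {d : Type*} [Fintype d] [DecidableEq d]

/-- `Tr |A| ^ q` for Hermitian `A`. -/
def absMoment (q : ℝ) (A : Matrix d d ℂ) : ℝ := (cfc (fun t : ℝ => |t| ^ q) A).trace.re

theorem Diagonalizes.absMoment_eq {U A : Matrix d d ℂ} {a : d → ℝ} (h : Diagonalizes U a A)
    (q : ℝ) : absMoment q A = ∑ i, |a i| ^ q := by
  rw [absMoment, (h.map _).trace_eq, Complex.ofReal_re]

theorem absMoment_nonneg {A : Matrix d d ℂ} (hA : A.IsHermitian) (q : ℝ) : 0 ≤ absMoment q A := by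
  obtain ⟨U, a, h⟩ := exists_diagonalizes hA
  rw [h.absMoment_eq]
  exact Finset.sum_nonneg fun i _ => Real.rpow_nonneg (abs_nonneg _) _

theorem schattenNorm_eq {A : Matrix d d ℂ} (hA : A.IsHermitian) (q : ℝ) :
    schattenNorm q A = absMoment q A ^ (1 / q) := by
  obtain ⟨U, a, h⟩ := exists_diagonalizes hA
  have h1 : Diagonalizes U (fun i => |a i| ^ q) (power (absolute A) q) := by
    have := ((h.mul h).map Real.sqrt).map (fun t => t ^ q)
    simp only [Real.sqrt_mul_self_eq_abs] at this
    rwa [power, absolute, hA.eq]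
  rw [schattenNorm, h1.trace_eq, h.absMoment_eq, Complex.ofReal_re]

theorem Diagonalizes.smul {U A : Matrix d d ℂ} {a : d → ℝ} (h : Diagonalizes U a A) (c : ℝ) :
    Diagonalizes U (fun i => c * a i) ((c : ℂ) • A) := by
  refine ⟨h.left_inv, ?_⟩
  have : (Matrix.diagonal fun i => ((c * a i : ℝ) : ℂ)) =
      (c : ℂ) • Matrix.diagonal fun i => (a i : ℂ) := by
    rw [← Matrix.diagonal_smul]
    congr 1
    ext i
    simp
  rw [this, Matrix.mul_smul, Matrix.smul_mul, ← h.eq]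

theorem absMoment_smul {A : Matrix d d ℂ} (hA : A.IsHermitian) (q c : ℝ) :
    absMoment q ((c : ℂ) • A) = |c| ^ q * absMoment q A := by
  obtain ⟨U, a, h⟩ := exists_diagonalizes hA
  rw [h.absMoment_eq, (h.smul c).absMoment_eq, Finset.mul_sum]
  refine Finset.sum_congr rfl fun i _ => ?_
  rw [abs_mul, Real.mul_rpow (abs_nonneg _) (abs_nonneg _)]

theorem convexOn_abs_rpow {q : ℝ} (hq : 1 ≤ q) : ConvexOn ℝ Set.univ fun t : ℝ => |t| ^ q := by
  refine ⟨convex_univ, fun x _ y _ a b ha hb hab => ?_⟩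
  have h1 : |a • x + b • y| ≤ a • |x| + b • |y| := by
    simp only [smul_eq_mul]
    refine (abs_add_le _ _).trans ?_
    rw [abs_mul, abs_mul, abs_of_nonneg ha, abs_of_nonneg hb]
  exact (Real.rpow_le_rpow (abs_nonneg _) h1 (by linarith)).trans
    ((convexOn_rpow hq).2 (abs_nonneg x) (abs_nonneg y) ha hb hab)

theorem absMoment_sum_le {ι : Type*} (t : Finset ι) {q : ℝ} (hq : 1 ≤ q) (p : ι → ℝ)
    (hp : ∀ k ∈ t, 0 ≤ p k) (hp1 : ∑ k ∈ t, p k = 1)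
    (A : ι → Matrix d d ℂ) (hA : ∀ k ∈ t, (A k).IsHermitian) :
    absMoment q (∑ k ∈ t, (p k : ℂ) • A k) ≤ ∑ k ∈ t, p k * absMoment q (A k) :=
  trace_cfc_sum_le t (convexOn_abs_rpow hq) p hp hp1 A hA fun _ _ _ _ _ _ => Set.mem_univ _

theorem isHermitian_smul {d : Type*} {A : Matrix d d ℂ} (hA : A.IsHermitian) (c : ℝ) :
    ((c : ℂ) • A).IsHermitian := by
  rw [Matrix.IsHermitian, Matrix.conjTranspose_smul, hA.eq, RCLike.star_def, Complex.conj_ofReal]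

theorem absMoment_sub_le {q : ℝ} (hq : 1 ≤ q) {A B : Matrix d d ℂ} (hA : A.IsHermitian)
    (hB : B.IsHermitian) :
    absMoment q (A - B) ≤ 2 ^ (q - 1) * (absMoment q A + absMoment q B) := by
  -- Convexity at the midpoint `A - B = (1 / 2) (2 A) + (1 / 2) (-2 B)`.
  have h := absMoment_sum_le (Finset.univ : Finset (Fin 2)) hq ![1 / 2, 1 / 2]
    (by intro k _; fin_cases k <;> norm_num) (by norm_num)
    ![((2 : ℝ) : ℂ) • A, ((-2 : ℝ) : ℂ) • B]
    (by
      intro k _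
      fin_cases k
      · exact isHermitian_smul hA 2
      · exact isHermitian_smul hB (-2))
  have h1 : ∑ k : Fin 2, (((![1 / 2, 1 / 2] : Fin 2 → ℝ) k : ℝ) : ℂ) •
      (![((2 : ℝ) : ℂ) • A, ((-2 : ℝ) : ℂ) • B] : Fin 2 → Matrix d d ℂ) k = A - B := by
    rw [Fin.sum_univ_two]
    simp only [Matrix.cons_val_zero, Matrix.cons_val_one, smul_smul]
    norm_num
    rw [sub_eq_add_neg]
  rw [h1, Fin.sum_univ_two] at h
  simp only [Matrix.cons_val_zero, Matrix.cons_val_one, absMoment_smul hA, absMoment_smul hB] at h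
  refine h.trans_eq ?_
  rw [Real.rpow_sub_one (by norm_num)]
  norm_num
  ring

/-- The two-point Clarkson inequality. -/
theorem absMoment_add_add_sub_le {q : ℝ} (hq : 1 ≤ q) (hq2 : q ≤ 2) {A B : Matrix d d ℂ}
    (hA : A.IsHermitian) (hB : B.IsHermitian) :
    absMoment q (A + B) + absMoment q (A - B) ≤ 2 * (absMoment q A + absMoment q B) := by
  -- Moments are traces of `t ^ (q / 2)` at the squares, and this function is concave because `q ≤
  -- 2`. The squares of `A + B` and `A - B` average to `A * A + B * B`: concavity handles the
  -- average, subadditivity the sum.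
  have hsq : ∀ {A : Matrix d d ℂ}, A.IsHermitian →
      absMoment q A = (cfc (fun t : ℝ => t ^ (q / 2)) (A * A)).trace.re := by
    intro A hA
    obtain ⟨U, a, h⟩ := exists_diagonalizes hA
    rw [h.absMoment_eq, ((h.mul h).map _).trace_eq, Complex.ofReal_re]
    refine Finset.sum_congr rfl fun i _ => ?_
    rw [← abs_mul_abs_self (a i), ← pow_two, ← Real.rpow_natCast, ← Real.rpow_mul (abs_nonneg _)]
    congr 1
    push_cast
    ring
  have hconc : ConcaveOn ℝ (Set.Ici 0) fun t : ℝ => t ^ (q / 2) :=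
    Real.concaveOn_rpow (by linarith) (by linarith)
  have h0 : (0 : ℝ) ^ (q / 2) = 0 := Real.zero_rpow (by linarith)
  have hps : ∀ {A : Matrix d d ℂ}, A.IsHermitian → (A * A).PosSemidef := by
    intro A hA
    have := Matrix.posSemidef_conjTranspose_mul_self A
    rwa [hA.eq] at this
  have hP := hps (hA.add hB)
  have hM := hps (hA.sub hB)
  have hj := trace_cfc_sum_le (Finset.univ : Finset (Fin 2)) hconc.neg ![1 / 2, 1 / 2]
    (by intro k _; fin_cases k <;> norm_num) (by norm_num)
    ![(A + B) * (A + B), (A - B) * (A - B)]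
    (by
      intro k _
      fin_cases k
      · exact hP.isHermitian
      · exact hM.isHermitian)
    (by
      intro k _
      fin_cases k
      · exact fun U a h i => h.nonneg hP i
      · exact fun U a h i => h.nonneg hM i)
  have h1 : ∑ k : Fin 2, (((![1 / 2, 1 / 2] : Fin 2 → ℝ) k : ℝ) : ℂ) •
      (![(A + B) * (A + B), (A - B) * (A - B)] : Fin 2 → Matrix d d ℂ) k = A * A + B * B := by
    rw [Fin.sum_univ_two]
    simp only [Matrix.cons_val_zero, Matrix.cons_val_one, ← smul_add]
    have : (A + B) * (A + B) + (A - B) * (A - B) = (2 : ℂ) • (A * A + B * B) := by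
      rw [two_smul]; noncomm_ring
    rw [this, smul_smul]
    norm_num
  have hneg : ∀ {A : Matrix d d ℂ}, A.IsHermitian →
      (cfc (-fun t : ℝ => t ^ (q / 2)) A).trace.re =
        -(cfc (fun t : ℝ => t ^ (q / 2)) A).trace.re := by
    intro A hA
    obtain ⟨U, a, h⟩ := exists_diagonalizes hA
    rw [(h.map _).trace_eq, (h.map _).trace_eq]
    simp
  rw [h1, Fin.sum_univ_two] at hj
  simp only [Matrix.cons_val_zero, Matrix.cons_val_one] at hj
  rw [hneg hP.isHermitian, hneg hM.isHermitian,
    hneg ((hps hA).add (hps hB)).isHermitian] at hj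
  have hR := trace_cfc_sq_add_sq_le hconc h0 hA hB
  rw [hsq (hA.add hB), hsq (hA.sub hB), hsq hA, hsq hB]
  linarith

/-- Hölder's inequality for Schatten norms of Hermitian matrices. -/
theorem re_trace_mul_le {q r : ℝ} (hqr : q.HolderConjugate r) {A B : Matrix d d ℂ}
    (hA : A.IsHermitian) (hB : B.IsHermitian) :
    (A * B).trace.re ≤ absMoment q A ^ (1 / q) * absMoment r B ^ (1 / r) := by
  obtain ⟨U, a, hU⟩ := exists_diagonalizes hA
  obtain ⟨V, b, hV⟩ := exists_diagonalizes hB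
  rw [hU.trace_mul hV, Complex.ofReal_re, hU.absMoment_eq, hV.absMoment_eq,
    ← Fintype.sum_prod_type']
  have hw : ∀ x : d × d, 0 ≤ overlap U V x.1 x.2 := fun x => overlap_nonneg _ _ _ _
  -- Scalar Hölder over pairs of indices, with the overlap split as `w ^ (1 / q) * w ^ (1 / r)`; row
  -- and column sums `1` then recover the two moments.
  have h := Real.inner_le_Lp_mul_Lq (Finset.univ : Finset (d × d))
    (fun x => overlap U V x.1 x.2 ^ (1 / q) * a x.1)
    (fun x => overlap U V x.1 x.2 ^ (1 / r) * b x.2) hqr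
  have e1 : ∀ x : d × d, |overlap U V x.1 x.2 ^ (1 / q) * a x.1| ^ q =
      overlap U V x.1 x.2 * |a x.1| ^ q := by
    intro x
    rw [abs_mul, Real.mul_rpow (abs_nonneg _) (abs_nonneg _),
      abs_of_nonneg (Real.rpow_nonneg (hw x) _), ← Real.rpow_mul (hw x),
      one_div_mul_cancel hqr.ne_zero, Real.rpow_one]
  have e2 : ∀ x : d × d, |overlap U V x.1 x.2 ^ (1 / r) * b x.2| ^ r =
      overlap U V x.1 x.2 * |b x.2| ^ r := by
    intro x
    rw [abs_mul, Real.mul_rpow (abs_nonneg _) (abs_nonneg _),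
      abs_of_nonneg (Real.rpow_nonneg (hw x) _), ← Real.rpow_mul (hw x),
      one_div_mul_cancel hqr.symm.ne_zero, Real.rpow_one]
  have e3 : ∀ x : d × d, overlap U V x.1 x.2 ^ (1 / q) * a x.1 *
      (overlap U V x.1 x.2 ^ (1 / r) * b x.2) = overlap U V x.1 x.2 * a x.1 * b x.2 := by
    intro x
    have : overlap U V x.1 x.2 ^ (1 / q) * overlap U V x.1 x.2 ^ (1 / r) =
        overlap U V x.1 x.2 := by
      have h1 : 1 / q + 1 / r = 1 := by
        rw [one_div, one_div, hqr.inv_add_inv_eq_one]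
      rw [← Real.rpow_add_of_nonneg (hw x) (one_div_nonneg.2 hqr.nonneg)
        (one_div_nonneg.2 hqr.symm.nonneg), h1, Real.rpow_one]
    calc _ = (overlap U V x.1 x.2 ^ (1 / q) * overlap U V x.1 x.2 ^ (1 / r)) * a x.1 * b x.2 := by
          ring
      _ = _ := by rw [this]
  simp_rw [e1, e2, e3] at h
  refine h.trans_eq ?_
  congr 2
  · rw [Fintype.sum_prod_type]
    refine Finset.sum_congr rfl fun i _ => ?_
    simp only [← Finset.sum_mul]
    rw [sum_overlap_right hU.left_inv hV.left_inv, one_mul]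
  · rw [Fintype.sum_prod_type_right]
    refine Finset.sum_congr rfl fun i _ => ?_
    simp only [← Finset.sum_mul]
    rw [sum_overlap_left hU.left_inv hV.left_inv, one_mul]

/-- In an eigenbasis of `H` the hypotheses say that `|a i|` is at most the `i`-th diagonal entry of
`P`; Peierls' inequality bounds the moment of that diagonal by the moment of `P`. -/
theorem absMoment_le_of_neg_le_of_le {q : ℝ} (hq : 1 ≤ q) {H P : Matrix d d ℂ}
    (hH : H.IsHermitian) (hP : P.IsHermitian) (h1 : (P - H).PosSemidef) (h2 : (P + H).PosSemidef) :
    absMoment q H ≤ absMoment q P := by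
  obtain ⟨U, a, hU⟩ := exists_diagonalizes hH
  obtain ⟨V, b, hV⟩ := exists_diagonalizes hP
  refine le_trans ?_ (hV.sum_map_diag_le (convexOn_abs_rpow hq) (fun _ => Set.mem_univ _)
    hU.left_inv)
  rw [hU.absMoment_eq]
  refine Finset.sum_le_sum fun i _ => Real.rpow_le_rpow (abs_nonneg _) ?_ (by linarith)
  have hre : ((Uᴴ * H * U) i i).re = a i := by
    rw [hU.conjTranspose_mul_mul, Matrix.diagonal_apply_eq, Complex.ofReal_re]
  have k1 := (Complex.nonneg_iff.1 ((h1.conjTranspose_mul_mul_same U).diag_nonneg (i := i))).1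
  have k2 := (Complex.nonneg_iff.1 ((h2.conjTranspose_mul_mul_same U).diag_nonneg (i := i))).1
  rw [Matrix.mul_sub, Matrix.sub_mul, Matrix.sub_apply, Complex.sub_re, hre] at k1
  rw [Matrix.mul_add, Matrix.add_mul, Matrix.add_apply, Complex.add_re, hre] at k2
  rw [abs_le]
  have := le_abs_self ((Uᴴ * P * U) i i).re
  constructor <;> linarith

end AbsMoment

/-! ### One-shot soft covering -/

section OneShot

variable {d : Type*} [Fintype d] [DecidableEq d]

theorem isHermitian_cfc {A : Matrix d d ℂ} (hA : A.IsHermitian) (f : ℝ → ℝ) :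
    (cfc f A).IsHermitian := by
  obtain ⟨U, a, h⟩ := exists_diagonalizes hA
  exact (h.map f).isHermitian

theorem isHermitian_conj {A K : Matrix d d ℂ} (hA : A.IsHermitian) (hK : K.IsHermitian) :
    (K * A * K).IsHermitian := by
  rw [Matrix.IsHermitian, Matrix.conjTranspose_mul, Matrix.conjTranspose_mul, hA.eq, hK.eq,
    Matrix.mul_assoc]

theorem posSemidef_conj {A K : Matrix d d ℂ} (hA : A.PosSemidef) (hK : K.IsHermitian) :
    (K * A * K).PosSemidef := by
  have := hA.conjTranspose_mul_mul_same K
  rwa [hK.eq] at this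

theorem cfc_mul_cfc {A : Matrix d d ℂ} (hA : A.IsHermitian) (f g : ℝ → ℝ) :
    cfc f A * cfc g A = cfc (fun t => f t * g t) A := by
  obtain ⟨U, a, h⟩ := exists_diagonalizes hA
  exact ((h.map f).mul (h.map g)).unique (h.map fun t => f t * g t)

/-- A function that is `1` off `0` acts as the identity on the support. -/
theorem SuppLE.mul_cfc {ρ σ : Matrix d d ℂ} (h : SuppLE ρ σ) (hσ : σ.IsHermitian) {g : ℝ → ℝ}
    (hg : ∀ t ∈ spectrum ℝ σ, t ≠ 0 → g t = 1) : ρ * cfc g σ = ρ := by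
  have h1 : ρ * cfc (fun t => 1 - g t) σ = 0 := by
    have h2 : σ * cfc (fun t => 1 - g t) σ = 0 := by
      obtain ⟨V, b, hV⟩ := exists_diagonalizes hσ
      have h3 : cfc (fun t : ℝ => t * (1 - g t)) σ = 0 := by
        rw [← cfc_zero ℝ σ]
        refine cfc_congr fun t ht => ?_
        by_cases h0 : t = 0
        · simp [h0]
        · simp [hg t ht h0]
      have h4 := cfc_mul_cfc hσ (fun t => t) (fun t => 1 - g t)
      rw [h3, cfc_id' ℝ σ hσ.isSelfAdjoint] at h4
      exact h4
    ext i j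
    have h5 := h (fun k => cfc (fun t => 1 - g t) σ k j) (by
      ext i
      exact congrFun (congrFun h2 i) j)
    exact congrFun h5 i
  have h6 : cfc g σ + cfc (fun t => 1 - g t) σ = 1 := by
    obtain ⟨V, b, hV⟩ := exists_diagonalizes hσ
    rw [(hV.map g).eq, (hV.map fun t => 1 - g t).eq, ← Matrix.add_mul, ← Matrix.mul_add,
      Matrix.diagonal_add]
    simp [hV.right_inv]
  calc ρ * cfc g σ = ρ * (cfc g σ + cfc (fun t => 1 - g t) σ) := by
        rw [Matrix.mul_add, h1, add_zero]
    _ = ρ := by rw [h6, Matrix.mul_one]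

theorem spectrum_nonneg {σ : Matrix d d ℂ} (hσ : σ.PosSemidef) {t : ℝ} (ht : t ∈ spectrum ℝ σ) :
    0 ≤ t := by
  rw [hσ.isHermitian.spectrum_real_eq_range_eigenvalues] at ht
  obtain ⟨i, rfl⟩ := ht
  exact hσ.eigenvalues_nonneg i

theorem SuppLE.mul_power_mul_power {ρ σ : Matrix d d ℂ} (h : SuppLE ρ σ) (hσ : σ.PosSemidef)
    (r : ℝ) : ρ * power σ (-r) * power σ r = ρ := by
  rw [Matrix.mul_assoc, power, power, cfc_mul_cfc hσ.isHermitian]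
  refine h.mul_cfc hσ.isHermitian fun t ht h0 => ?_
  rw [← Real.rpow_add (lt_of_le_of_ne (spectrum_nonneg hσ ht) (Ne.symm h0))]
  simp

/-- `‖Y‖_1 ≤ ‖σ ^ (-r) Y σ ^ (-r)‖_α` with `r = (α - 1) / (2 α)`, for a density operator `σ` whose
support contains that of `Y`. -/
theorem schattenNorm_one_le {σ Y : Matrix d d ℂ} (hσ : IsDensity σ) (hY : Y.IsHermitian)
    (hsupp : SuppLE Y σ) {α : ℝ} (hα : 1 < α) :
    schattenNorm 1 Y ≤ absMoment α (power σ ((1 - α) / (2 * α)) * Y *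
      power σ ((1 - α) / (2 * α))) ^ (1 / α) := by
  set r : ℝ := (α - 1) / (2 * α) with hr
  have hrneg : (1 - α) / (2 * α) = -r := by rw [hr]; ring
  have hα0 : 0 < α := by linarith
  have hr0 : 0 < r := by rw [hr]; apply div_pos <;> linarith
  rw [hrneg]
  set K := power σ (-r) with hK
  set S := power σ r with hS
  have hKH : K.IsHermitian := isHermitian_cfc hσ.1.isHermitian _
  have hSH : S.IsHermitian := isHermitian_cfc hσ.1.isHermitian _
  have hYKS : Y * K * S = Y := hsupp.mul_power_mul_power hσ.1 r
  have hSKY : S * K * Y = Y := by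
    have := congrArg Matrix.conjTranspose hYKS
    rw [Matrix.conjTranspose_mul, Matrix.conjTranspose_mul, hY.eq, hKH.eq, hSH.eq] at this
    rwa [Matrix.mul_assoc]
  obtain ⟨U, y, hU⟩ := exists_diagonalizes hY
  -- The sign of `Y` attains the trace norm. Inserting `S * K`, which acts as the identity on `Y`,
  -- turns `Tr (Y G)` into a pairing of `K Y K` with `S G S`, and `-1 ≤ G ≤ 1` places the latter
  -- between `-S²` and `S²`.
  set G := cfc (fun t : ℝ => (SignType.sign t : ℝ)) Y with hG
  have hUG := hU.map (fun t : ℝ => (SignType.sign t : ℝ))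
  rw [← hG] at hUG
  have h1 : schattenNorm 1 Y = (Y * G).trace.re := by
    rw [schattenNorm_eq hY, hU.absMoment_eq, (hU.mul hUG).trace_eq, Complex.ofReal_re]
    simp [self_mul_sign]
  have h2 : (Y * G).trace = (K * Y * K * (S * G * S)).trace := by
    calc (Y * G).trace = (S * (K * Y * K) * S * G).trace := by
          congr 2
          calc Y = S * K * (Y * K * S) := by rw [hYKS, hSKY]
            _ = _ := by simp only [Matrix.mul_assoc]
      _ = (S * ((K * Y * K) * (S * G))).trace := by simp only [Matrix.mul_assoc]
      _ = _ := by rw [Matrix.trace_mul_comm]; simp only [Matrix.mul_assoc]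
  have hconj : α.HolderConjugate (α / (α - 1)) := Real.HolderConjugate.conjExponent hα
  have h3 := re_trace_mul_le hconj (isHermitian_conj hY hKH) (isHermitian_conj hUG.isHermitian hSH)
  have hPS : ∀ c : ℝ, |c| ≤ 1 → (1 + (c : ℂ) • G).PosSemidef := by
    intro c hc
    have : 1 + (c : ℂ) • G = cfc (fun t : ℝ => 1 + c * (SignType.sign t : ℝ)) Y := by
      rw [(hU.map _).eq, (hUG.smul c).eq, (diagonalizes_one hU.left_inv).eq, ← Matrix.add_mul,
        ← Matrix.mul_add, Matrix.diagonal_add]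
      simp
    rw [this]
    refine (hU.map _).posSemidef fun i => ?_
    have hs : |((SignType.sign (y i) : SignType) : ℝ)| ≤ 1 := by
      rcases SignType.sign (y i) with _ | _ | _ <;> simp
    have := abs_mul c ((SignType.sign (y i) : SignType) : ℝ)
    have h5 : |c * ((SignType.sign (y i) : SignType) : ℝ)| ≤ 1 := by
      rw [this]; exact mul_le_one₀ hc (abs_nonneg _) hs
    linarith [(abs_le.1 h5).1]
  have h4 : absMoment (α / (α - 1)) (S * G * S) ≤ absMoment (α / (α - 1)) (S * S) := by
    have hSS : (S * S).IsHermitian := by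
      have := isHermitian_conj Matrix.isHermitian_one hSH
      rwa [Matrix.mul_one] at this
    refine absMoment_le_of_neg_le_of_le hconj.symm.lt.le (isHermitian_conj hUG.isHermitian hSH)
      hSS ?_ ?_
    · have := posSemidef_conj (hPS (-1) (by norm_num)) hSH
      convert this using 1
      push_cast
      simp only [Matrix.mul_add, Matrix.add_mul, Matrix.mul_one, neg_smul, one_smul, Matrix.mul_neg, Matrix.neg_mul, sub_eq_add_neg]
    · have := posSemidef_conj (hPS 1 (by norm_num)) hSH
      convert this using 1
      push_cast
      simp only [Matrix.mul_add, Matrix.add_mul, Matrix.mul_one, one_smul]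
  -- The choice of `r` makes `2 r` times the dual exponent equal to `1`, so the moment is `Tr σ`.
  have h5 : absMoment (α / (α - 1)) (S * S) = 1 := by
    obtain ⟨V, b, hV⟩ := exists_diagonalizes hσ.1.isHermitian
    have hb := hV.nonneg hσ.1
    have hVS := hV.map (fun t => t ^ r)
    have hSe : cfc (fun t : ℝ => t ^ r) σ = S := rfl
    rw [hSe] at hVS
    rw [(hVS.mul hVS).absMoment_eq]
    have htr := hV.trace_eq
    rw [hσ.2] at htr
    have htr' : ∑ i, b i = 1 := by exact_mod_cast htr.symm
    refine (Finset.sum_congr rfl fun i _ => ?_).trans htr'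
    rw [abs_of_nonneg (mul_nonneg (Real.rpow_nonneg (hb i) _) (Real.rpow_nonneg (hb i) _)),
      ← Real.rpow_add_of_nonneg (hb i) hr0.le hr0.le, ← Real.rpow_mul (hb i)]
    have : (r + r) * (α / (α - 1)) = 1 := by
      have : α - 1 ≠ 0 := by linarith
      rw [hr]; field_simp; norm_num
    rw [this, Real.rpow_one]
  rw [h1, h2]
  refine h3.trans ?_
  have h6 : absMoment (α / (α - 1)) (S * G * S) ^ (1 / (α / (α - 1))) ≤ 1 := by
    refine Real.rpow_le_one (absMoment_nonneg (isHermitian_conj hUG.isHermitian hSH) _)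
      (h4.trans h5.le) (one_div_nonneg.2 hconj.symm.nonneg)
  exact mul_le_of_le_one_right
    (Real.rpow_nonneg (absMoment_nonneg (isHermitian_conj hY hKH) _) _) h6

variable {X : Type*} [Fintype X]

theorem isHermitian_outputState {p : X → ℝ} {T : X → Matrix d d ℂ} (hT : ∀ x, (T x).IsHermitian) :
    (outputState p T).IsHermitian := by
  rw [outputState, Matrix.IsHermitian, Matrix.conjTranspose_sum]
  exact Finset.sum_congr rfl fun x _ => (isHermitian_smul (hT x) (p x)).eq

theorem isHermitian_sum {ι : Type*} (t : Finset ι) {A : ι → Matrix d d ℂ}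
    (hA : ∀ k, (A k).IsHermitian) : (∑ k ∈ t, A k).IsHermitian := by
  rw [Matrix.IsHermitian, Matrix.conjTranspose_sum]
  exact Finset.sum_congr rfl fun x _ => (hA x).eq

/-- Adding one centred random matrix. -/
theorem sum_absMoment_add_sub_le {q : ℝ} (hq : 1 ≤ q) (hq2 : q ≤ 2) {p : X → ℝ}
    (hp : p ∈ stdSimplex ℝ X) {T : X → Matrix d d ℂ} (hT : ∀ x, (T x).IsHermitian)
    {B : Matrix d d ℂ} (hB : B.IsHermitian) :
    ∑ x, p x * absMoment q (B + (T x - outputState p T)) ≤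
      absMoment q B + 2 ^ q * ∑ x, p x * absMoment q (T x) := by
  -- Symmetrization: by convexity the mean may be replaced by an independent copy `T y`.
  have h1 : ∀ x, absMoment q (B + (T x - outputState p T)) ≤
      ∑ y, p y * absMoment q (B + (T x - T y)) := by
    intro x
    have h := absMoment_sum_le Finset.univ hq p (fun k _ => hp.1 k) hp.2
      (fun y => B + (T x - T y)) (fun y _ => hB.add ((hT x).sub (hT y)))
    convert h using 2
    have hs : ∑ k, (p k : ℂ) = 1 := by exact_mod_cast congrArg (fun t : ℝ => (t : ℂ)) hp.2
    simp only [smul_add, smul_sub, Finset.sum_add_distrib, Finset.sum_sub_distrib,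
      ← Finset.sum_smul, hs, one_smul, outputState]
  -- Exchanging `x` and `y` flips the sign of `T x - T y`, so both signs have the same expectation
  -- and Clarkson's inequality applies to their sum.
  have h2 : ∑ x, ∑ y, p x * p y * absMoment q (B + (T x - T y)) =
      ∑ x, ∑ y, p x * p y * absMoment q (B - (T x - T y)) := by
    rw [Finset.sum_comm]
    refine Finset.sum_congr rfl fun x _ => Finset.sum_congr rfl fun y _ => ?_
    rw [mul_comm (p y), show B + (T y - T x) = B - (T x - T y) by abel]
  have h3 : ∀ x y, absMoment q (B + (T x - T y)) + absMoment q (B - (T x - T y)) ≤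
      2 * (absMoment q B + 2 ^ (q - 1) * (absMoment q (T x) + absMoment q (T y))) := by
    intro x y
    refine (absMoment_add_add_sub_le hq hq2 hB ((hT x).sub (hT y))).trans ?_
    have := absMoment_sub_le hq (hT x) (hT y)
    linarith
  have h4 : ∑ x, p x * absMoment q (B + (T x - outputState p T)) ≤
      ∑ x, ∑ y, p x * p y * absMoment q (B + (T x - T y)) := by
    refine Finset.sum_le_sum fun x _ => ?_
    refine (mul_le_mul_of_nonneg_left (h1 x) (hp.1 x)).trans_eq ?_
    rw [Finset.mul_sum]
    exact Finset.sum_congr rfl fun y _ => by ring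
  have h5 : ∑ x, ∑ y, p x * p y * absMoment q (B + (T x - T y)) +
      ∑ x, ∑ y, p x * p y * absMoment q (B - (T x - T y)) ≤
      ∑ x, ∑ y, p x * p y *
        (2 * (absMoment q B + 2 ^ (q - 1) * (absMoment q (T x) + absMoment q (T y)))) := by
    rw [← Finset.sum_add_distrib]
    refine Finset.sum_le_sum fun x _ => ?_
    rw [← Finset.sum_add_distrib]
    refine Finset.sum_le_sum fun y _ => ?_
    rw [← mul_add]
    exact mul_le_mul_of_nonneg_left (h3 x y) (mul_nonneg (hp.1 x) (hp.1 y))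
  have h6 : ∑ x, ∑ y, p x * p y *
        (2 * (absMoment q B + 2 ^ (q - 1) * (absMoment q (T x) + absMoment q (T y)))) =
      2 * (absMoment q B + 2 ^ q * ∑ x, p x * absMoment q (T x)) := by
    have e1 : ∀ x, ∑ y, p x * p y *
        (2 * (absMoment q B + 2 ^ (q - 1) * (absMoment q (T x) + absMoment q (T y)))) =
        p x * (2 * absMoment q B + 2 ^ q * absMoment q (T x) +
          2 ^ q * ∑ y, p y * absMoment q (T y)) := by
      intro x
      have e2 : (2 : ℝ) ^ q = 2 * 2 ^ (q - 1) := by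
        rw [Real.rpow_sub_one (by norm_num)]; ring
      calc _ = ∑ y, (p y * (p x * (2 * absMoment q B + 2 ^ q * absMoment q (T x))) +
            p x * 2 ^ q * (p y * absMoment q (T y))) := by
              refine Finset.sum_congr rfl fun y _ => ?_
              rw [e2]; ring
        _ = _ := by
          rw [Finset.sum_add_distrib, ← Finset.sum_mul, hp.2, ← Finset.mul_sum]
          ring
    simp_rw [e1, mul_add, Finset.sum_add_distrib]
    rw [← Finset.sum_mul, ← Finset.sum_mul, hp.2, Finset.mul_sum, Finset.mul_sum]
    have e3 : ∑ x, p x * (2 ^ q * absMoment q (T x)) = ∑ x, 2 ^ q * (p x * absMoment q (T x)) :=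
      Finset.sum_congr rfl fun x _ => by ring
    rw [e3]
    simp only [← Finset.mul_sum]
    ring
  linarith

/-- Induction on `M`: the first codeword's deviation is absorbed into `B`, which is why `B` is
arbitrary; the application takes `B = 0`. -/
theorem sum_prod_absMoment_le {q : ℝ} (hq : 1 ≤ q) (hq2 : q ≤ 2) {p : X → ℝ}
    (hp : p ∈ stdSimplex ℝ X) {T : X → Matrix d d ℂ} (hT : ∀ x, (T x).IsHermitian) (M : ℕ)
    {B : Matrix d d ℂ} (hB : B.IsHermitian) :
    ∑ c : Fin M → X, (∏ m, p (c m)) * absMoment q (B + ∑ m, (T (c m) - outputState p T)) ≤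
      absMoment q B + M * (2 ^ q * ∑ x, p x * absMoment q (T x)) := by
  induction M generalizing B with
  | zero => simp
  | succ M ih =>
    rw [← (Fin.consEquiv fun _ => X).sum_comp, Fintype.sum_prod_type]
    have h1 : ∀ x, ∑ c : Fin M → X, (∏ m, p ((Fin.consEquiv fun _ => X) (x, c) m)) *
        absMoment q (B + ∑ m, (T ((Fin.consEquiv fun _ => X) (x, c) m) - outputState p T)) ≤
        p x * (absMoment q (B + (T x - outputState p T)) +
          M * (2 ^ q * ∑ x, p x * absMoment q (T x))) := by
      intro x
      refine le_trans (le_of_eq ?_) (mul_le_mul_of_nonneg_left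
        (ih (hB.add ((hT x).sub (isHermitian_outputState hT)))) (hp.1 x))
      rw [Finset.mul_sum]
      refine Finset.sum_congr rfl fun c _ => ?_
      simp only [Fin.consEquiv_apply, Fin.prod_univ_succ, Fin.sum_univ_succ, Fin.cons_zero,
        Fin.cons_succ]
      rw [mul_assoc, add_assoc]
    refine (Finset.sum_le_sum fun x _ => h1 x).trans ?_
    simp only [mul_add, Finset.sum_add_distrib]
    rw [← Finset.sum_mul, hp.2]
    have := sum_absMoment_add_sub_le hq hq2 hp hT hB
    push_cast
    linarith

theorem sum_prod_eq_one {p : X → ℝ} (hp : p ∈ stdSimplex ℝ X) (M : ℕ) :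
    ∑ c : Fin M → X, ∏ m, p (c m) = 1 := by
  have h := Finset.prod_univ_sum (fun _ : Fin M => (Finset.univ : Finset X)) (fun _ x => p x)
  rw [Fintype.piFinset_univ] at h
  rw [← h]
  simp [hp.2]

theorem SuppLE.smul {ρ σ : Matrix d d ℂ} (h : SuppLE ρ σ) (c : ℂ) : SuppLE (c • ρ) σ := by
  intro v hv
  rw [Matrix.smul_mulVec, h v hv, smul_zero]

theorem SuppLE.sub {ρ ρ' σ : Matrix d d ℂ} (h : SuppLE ρ σ) (h' : SuppLE ρ' σ) :
    SuppLE (ρ - ρ') σ := by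
  intro v hv
  rw [Matrix.sub_mulVec, h v hv, h' v hv, sub_zero]

theorem SuppLE.sum {ι : Type*} (t : Finset ι) {ρ : ι → Matrix d d ℂ} {σ : Matrix d d ℂ}
    (h : ∀ k ∈ t, SuppLE (ρ k) σ) : SuppLE (∑ k ∈ t, ρ k) σ := by
  intro v hv
  rw [Matrix.sum_mulVec]
  exact Finset.sum_eq_zero fun k hk => h k hk v hv

theorem SuppLE.outputState {p : X → ℝ} {ρ : X → Matrix d d ℂ} {σ : Matrix d d ℂ}
    (h : ∀ x, p x ≠ 0 → SuppLE (ρ x) σ) : SuppLE (outputState p ρ) σ := by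
  refine SuppLE.sum _ fun x _ => ?_
  by_cases hx : p x = 0
  · intro v _
    simp [hx]
  · exact (h x hx).smul _

/-- One-shot soft covering. -/
theorem expectedTraceDistance_le {p : X → ℝ} (hp : p ∈ stdSimplex ℝ X) {ρ : X → Matrix d d ℂ}
    (hρ : ∀ x, (ρ x).IsHermitian) {σ : Matrix d d ℂ} (hσ : IsDensity σ)
    (hsupp : ∀ x, p x ≠ 0 → SuppLE (ρ x) σ) {α : ℝ} (hα : 1 < α) (hα2 : α ≤ 2) {M : ℕ}
    (hM : 0 < M) :
    expectedTraceDistance M p ρ (outputState p ρ) ≤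
      ((M : ℝ) ^ (1 - α) * ∑ x, p x * absMoment α (power σ ((1 - α) / (2 * α)) * ρ x *
        power σ ((1 - α) / (2 * α)))) ^ (1 / α) := by
  have hα0 : 0 < α := by linarith
  have hM0 : (0 : ℝ) < M := by exact_mod_cast hM
  set K := power σ ((1 - α) / (2 * α)) with hK
  have hKH : K.IsHermitian := isHermitian_cfc hσ.1.isHermitian _
  set T : X → Matrix d d ℂ := fun x => K * ρ x * K with hT
  have hTH : ∀ x, (T x).IsHermitian := fun x => isHermitian_conj (hρ x) hKH
  set Q := ∑ x, p x * absMoment α (T x) with hQ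
  have hQ0 : 0 ≤ Q := Finset.sum_nonneg fun x _ => mul_nonneg (hp.1 x) (absMoment_nonneg (hTH x) _)
  have hP0 : ∀ c : Fin M → X, 0 ≤ ∏ m, p (c m) := fun c => Finset.prod_nonneg fun m _ => hp.1 _
  set Z : (Fin M → X) → Matrix d d ℂ := fun c => ∑ m, (T (c m) - outputState p T) with hZ
  have hZH : ∀ c, (Z c).IsHermitian := fun c =>
    isHermitian_sum _ fun m => (hTH _).sub (isHermitian_outputState hTH)
  have hconj : ∀ c, K * (codebookState ρ c - outputState p ρ) * K =
      (((1 / M : ℝ)) : ℂ) • Z c := by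
    intro c
    have h1 : K * outputState p ρ * K = outputState p T := by
      simp only [outputState, Matrix.mul_sum, Matrix.sum_mul, Matrix.mul_smul, Matrix.smul_mul, hT]
    have h2 : K * codebookState ρ c * K = (1 / (M : ℂ)) • ∑ m, T (c m) := by
      simp only [codebookState, Matrix.mul_sum, Matrix.sum_mul, Matrix.mul_smul, Matrix.smul_mul,
        hT]
    rw [Matrix.mul_sub, Matrix.sub_mul, h1, h2, hZ]
    simp only [Finset.sum_sub_distrib, Finset.sum_const, Finset.card_univ, Fintype.card_fin,
      smul_sub]
    rw [← Nat.cast_smul_eq_nsmul ℂ, smul_smul]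
    have : (M : ℂ) ≠ 0 := by exact_mod_cast hM.ne'
    push_cast
    rw [one_div, inv_mul_cancel₀ this, one_smul]
  have hone : ∀ c, (∏ m, p (c m)) * schattenNorm 1 (codebookState ρ c - outputState p ρ) ≤
      (∏ m, p (c m)) * ((1 / M) ^ α * absMoment α (Z c)) ^ (1 / α) := by
    intro c
    -- The support condition is known only for letters of positive probability, so codebooks of
    -- probability zero are set aside.
    by_cases hc : ∏ m, p (c m) = 0
    · simp [hc]
    · refine mul_le_mul_of_nonneg_left ?_ (hP0 c)
      have hc' : ∀ m, p (c m) ≠ 0 := fun m h => hc (Finset.prod_eq_zero (Finset.mem_univ m) h)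
      have hs : SuppLE (codebookState ρ c - outputState p ρ) σ :=
        ((SuppLE.sum _ fun m _ => hsupp _ (hc' m)).smul _).sub (SuppLE.outputState hsupp)
      have hH : (codebookState ρ c - outputState p ρ).IsHermitian := by
        refine Matrix.IsHermitian.sub ?_ (isHermitian_outputState hρ)
        have := isHermitian_smul (isHermitian_sum Finset.univ fun m => hρ (c m)) (1 / M : ℝ)
        rw [codebookState]
        push_cast at this
        exact this
      have h := schattenNorm_one_le hσ hH hs hα
      rw [← hK, hconj c, absMoment_smul (hZH c), abs_of_nonneg (by positivity)] at h
      exact h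
  have hmom : ∑ c : Fin M → X, (∏ m, p (c m)) * absMoment α (Z c) ≤ M * (2 ^ α * Q) := by
    have h := sum_prod_absMoment_le hα.le hα2 hp hTH M (Matrix.isHermitian_zero (n := d) (α := ℂ))
    have h0 : absMoment α (0 : Matrix d d ℂ) = 0 := by
      have := absMoment_smul (Matrix.isHermitian_zero (n := d) (α := ℂ)) α 0
      rw [smul_zero, abs_zero, Real.zero_rpow hα0.ne', zero_mul] at this
      exact this
    simp only [zero_add, h0] at h
    exact h
  have hjen : ∑ c : Fin M → X, (∏ m, p (c m)) * ((1 / M) ^ α * absMoment α (Z c)) ^ (1 / α) ≤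
      (∑ c : Fin M → X, (∏ m, p (c m)) * ((1 / M) ^ α * absMoment α (Z c))) ^ (1 / α) := by
    have hc : ConcaveOn ℝ (Set.Ici 0) fun t : ℝ => t ^ (1 / α) :=
      Real.concaveOn_rpow (by positivity) (by rw [div_le_one hα0]; exact hα.le)
    exact hc.le_map_sum (fun c _ => hP0 c) (sum_prod_eq_one hp M) fun c _ =>
      mul_nonneg (by positivity) (absMoment_nonneg (hZH c) _)
  have hfin : ∑ c : Fin M → X, (∏ m, p (c m)) * ((1 / M) ^ α * absMoment α (Z c)) ≤
      2 ^ α * ((M : ℝ) ^ (1 - α) * Q) := by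
    calc _ = (1 / M) ^ α * ∑ c : Fin M → X, (∏ m, p (c m)) * absMoment α (Z c) := by
          rw [Finset.mul_sum]
          exact Finset.sum_congr rfl fun c _ => by ring
      _ ≤ (1 / M) ^ α * (M * (2 ^ α * Q)) := mul_le_mul_of_nonneg_left hmom (by positivity)
      _ = _ := by
        rw [Real.rpow_sub hM0, Real.rpow_one, one_div, Real.inv_rpow hM0.le]
        ring
  have hpos : 0 ≤ ∑ c : Fin M → X, (∏ m, p (c m)) * ((1 / M : ℝ) ^ α * absMoment α (Z c)) :=
    Finset.sum_nonneg fun c _ => mul_nonneg (hP0 c)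
      (mul_nonneg (by positivity) (absMoment_nonneg (hZH c) _))
  calc expectedTraceDistance M p ρ (outputState p ρ)
      ≤ 1 / 2 * (2 ^ α * ((M : ℝ) ^ (1 - α) * Q)) ^ (1 / α) := by
        rw [expectedTraceDistance]
        refine mul_le_mul_of_nonneg_left ?_ (by norm_num)
        refine (Finset.sum_le_sum fun c _ => hone c).trans (hjen.trans ?_)
        exact Real.rpow_le_rpow hpos hfin (by positivity)
    -- `(2 ^ α) ^ (1 / α) = 2` cancels the `1 / 2`, so no constant is left.
    _ = _ := by
        rw [Real.mul_rpow (by positivity) (by positivity), ← Real.rpow_mul (by norm_num),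
          mul_one_div_cancel hα0.ne', Real.rpow_one]
        ring

end OneShot

/-! ### Tensor powers and the bound for `n` uses -/

section Tensor

variable {d : Type*} [Fintype d] [DecidableEq d] {n : ℕ}

theorem prod_sum_pi {R Y : Type*} [CommSemiring R] [Fintype Y] (f : Fin n → Y → R) :
    ∏ i, ∑ y, f i y = ∑ g : Fin n → Y, ∏ i, f i (g i) := by
  have h := Finset.prod_univ_sum (fun _ : Fin n => (Finset.univ : Finset Y)) f
  rwa [Fintype.piFinset_univ] at h

theorem tensor_mul (A B : Fin n → Matrix d d ℂ) :
    tensor A * tensor B = tensor fun i => A i * B i := by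
  ext f g
  simp only [tensor, Matrix.mul_apply, Matrix.of_apply, prod_sum_pi, Finset.prod_mul_distrib]

theorem tensor_conjTranspose (A : Fin n → Matrix d d ℂ) :
    (tensor A)ᴴ = tensor fun i => (A i)ᴴ := by
  ext f g
  simp [tensor, Matrix.conjTranspose_apply]

theorem tensor_diagonal (a : Fin n → d → ℂ) :
    (tensor fun i => Matrix.diagonal (a i)) = Matrix.diagonal fun f => ∏ i, a i (f i) := by
  ext f g
  simp only [tensor, Matrix.of_apply]
  by_cases h : f = g
  · subst h
    simp
  · obtain ⟨i, hi⟩ := Function.ne_iff.1 h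
    rw [Matrix.diagonal_apply_ne _ h]
    exact Finset.prod_eq_zero (Finset.mem_univ i) (Matrix.diagonal_apply_ne _ hi)

theorem tensor_one : (tensor fun _ : Fin n => (1 : Matrix d d ℂ)) = 1 := by
  have h := tensor_diagonal (d := d) (n := n) fun _ _ => 1
  simpa using h

theorem trace_tensor (A : Fin n → Matrix d d ℂ) : (tensor A).trace = ∏ i, (A i).trace := by
  simp only [Matrix.trace, prod_sum_pi]
  rfl

theorem Diagonalizes.tensor {U A : Fin n → Matrix d d ℂ} {a : Fin n → d → ℝ}
    (h : ∀ i, Diagonalizes (U i) (a i) (A i)) :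
    Diagonalizes (tensor U) (fun f => ∏ i, a i (f i)) (tensor A) := by
  refine ⟨?_, ?_⟩
  · rw [tensor_conjTranspose, tensor_mul]
    simp only [(h _).left_inv, tensor_one]
  · have : (Matrix.diagonal fun f : Fin n → d => ((∏ i, a i (f i) : ℝ) : ℂ)) =
        SoftCovering.tensor fun i => Matrix.diagonal fun j => (a i j : ℂ) := by
      rw [tensor_diagonal]
      congr 1
      ext f
      push_cast
      rfl
    rw [this, tensor_conjTranspose, tensor_mul, tensor_mul]
    congr 1
    ext1 i
    exact (h i).eq

theorem isHermitian_tensor {A : Fin n → Matrix d d ℂ} (hA : ∀ i, (A i).IsHermitian) :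
    (tensor A).IsHermitian := by
  rw [Matrix.IsHermitian, tensor_conjTranspose]
  congr 1
  ext1 i
  exact hA i

theorem power_tensor {A : Fin n → Matrix d d ℂ} (hA : ∀ i, (A i).PosSemidef) (s : ℝ) :
    power (tensor A) s = tensor fun i => power (A i) s := by
  choose U a h using fun i => exists_diagonalizes (hA i).isHermitian
  have h1 := (Diagonalizes.tensor h).map fun t : ℝ => t ^ s
  have h2 := Diagonalizes.tensor fun i => (h i).map fun t : ℝ => t ^ s
  refine h1.unique ?_
  convert h2 using 2 with f
  · exact (Real.finsetProd_rpow _ _ (fun i _ => (h i).nonneg (hA i) _) s).symm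
  · rfl

theorem absMoment_tensor {A : Fin n → Matrix d d ℂ} (hA : ∀ i, (A i).IsHermitian) (q : ℝ) :
    absMoment q (tensor A) = ∏ i, absMoment q (A i) := by
  choose U a h using fun i => exists_diagonalizes (hA i)
  rw [(Diagonalizes.tensor h).absMoment_eq]
  simp only [(h _).absMoment_eq, prod_sum_pi]
  refine Finset.sum_congr rfl fun f _ => ?_
  rw [Finset.abs_prod, Real.finsetProd_rpow _ _ fun i _ => abs_nonneg _]

theorem IsDensity.tensor {A : Fin n → Matrix d d ℂ} (hA : ∀ i, IsDensity (A i)) :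
    IsDensity (tensor A) := by
  refine ⟨?_, ?_⟩
  · choose U a h using fun i => exists_diagonalizes (hA i).1.isHermitian
    exact (Diagonalizes.tensor h).posSemidef fun f =>
      Finset.prod_nonneg fun i _ => (h i).nonneg (hA i).1 _
  · rw [trace_tensor]
    exact Finset.prod_eq_one fun i _ => (hA i).2

theorem suppLE_of_eq_mul {ρ σ Y : Matrix d d ℂ} (h : ρ = Y * σ) : SuppLE ρ σ := by
  intro v hv
  rw [h, ← Matrix.mulVec_mulVec, hv, Matrix.mulVec_zero]

theorem power_one {σ : Matrix d d ℂ} (hσ : σ.IsHermitian) : power σ 1 = σ := by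
  simp only [power, Real.rpow_one]
  exact cfc_id' ℝ σ hσ.isSelfAdjoint

theorem SuppLE.tensor {ρ σ : Fin n → Matrix d d ℂ} (hσ : ∀ i, (σ i).PosSemidef)
    (h : ∀ i, SuppLE (ρ i) (σ i)) : SuppLE (tensor ρ) (tensor σ) := by
  -- A support inclusion is a factorization `ρ = Y * σ` with `Y = ρ σ ^ (-1)`, and factorizations
  -- can be tensored.
  refine suppLE_of_eq_mul (Y := SoftCovering.tensor fun i => ρ i * power (σ i) (-1)) ?_
  rw [tensor_mul]
  congr 1
  ext1 i
  have := (h i).mul_power_mul_power (hσ i) 1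
  rw [power_one (hσ i).isHermitian] at this
  exact this.symm

variable {X : Type*} [Fintype X]

theorem outputState_product (p : X → ℝ) (ρ : X → Matrix d d ℂ) :
    outputState (productDist n p) (productChannel n ρ) = tensor fun _ => outputState p ρ := by
  ext f g
  simp only [outputState, productDist, productChannel, tensor, Matrix.sum_apply, Matrix.smul_apply,
    Matrix.of_apply, smul_eq_mul, prod_sum_pi, Finset.prod_mul_distrib]
  push_cast
  rfl

theorem productDist_mem {p : X → ℝ} (hp : p ∈ stdSimplex ℝ X) :
    productDist n p ∈ stdSimplex ℝ (Fin n → X) :=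
  ⟨fun _ => Finset.prod_nonneg fun _ _ => hp.1 _, sum_prod_eq_one hp n⟩

/-- Powers and moments are multiplicative over tensor factors and the codeword distribution is a
product, so the sum over words splits into `n` equal factors. -/
theorem sum_absMoment_product (p : X → ℝ) {ρ : X → Matrix d d ℂ} (hρ : ∀ x, (ρ x).IsHermitian)
    {σ : Matrix d d ℂ} (hσ : σ.PosSemidef) (q s : ℝ) :
    ∑ x, productDist n p x * absMoment q (power (tensor fun _ => σ) s * productChannel n ρ x *
      power (tensor fun _ => σ) s) =
      (∑ x, p x * absMoment q (power σ s * ρ x * power σ s)) ^ n := by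
  have h : ∀ x : Fin n → X, absMoment q (power (tensor fun _ => σ) s * productChannel n ρ x *
      power (tensor fun _ => σ) s) = ∏ i, absMoment q (power σ s * ρ (x i) * power σ s) := by
    intro x
    rw [power_tensor fun _ => hσ, productChannel, tensor_mul, tensor_mul, absMoment_tensor]
    exact fun i => isHermitian_conj (hρ _) (isHermitian_cfc hσ.isHermitian _)
  simp_rw [h, productDist, ← Finset.prod_mul_distrib]
  rw [← prod_sum_pi fun _ x => p x * absMoment q (power σ s * ρ x * power σ s)]
  simp

/-- The `n`-shot bound for a fixed order and a fixed reference operator. -/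
theorem expectedTraceDistance_product_le {p : X → ℝ} (hp : p ∈ stdSimplex ℝ X)
    {ρ : X → Matrix d d ℂ} (hρ : ∀ x, (ρ x).IsHermitian) {σ : Matrix d d ℂ} (hσ : IsDensity σ)
    (hsupp : ∀ x, p x ≠ 0 → SuppLE (ρ x) σ) {α : ℝ} (hα : 1 < α) (hα2 : α ≤ 2) {M : ℕ}
    (hM : 0 < M) :
    expectedTraceDistance M (productDist n p) (productChannel n ρ)
        (tensor fun _ => outputState p ρ) ≤
      ((M : ℝ) ^ (1 - α) * (∑ x, p x * absMoment α (power σ ((1 - α) / (2 * α)) * ρ x *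
        power σ ((1 - α) / (2 * α)))) ^ n) ^ (1 / α) := by
  rw [← outputState_product, ← sum_absMoment_product p hρ hσ.1]
  refine expectedTraceDistance_le (productDist_mem hp) (fun x => isHermitian_tensor fun i => hρ _)
    (IsDensity.tensor fun _ => hσ) (fun x hx => ?_) hα hα2 hM
  exact SuppLE.tensor (fun _ => hσ.1) fun i =>
    hsupp _ fun h => hx (Finset.prod_eq_zero (Finset.mem_univ i) h)

end Tensor

/-! ### Relative entropy and the sandwiched divergence near order one -/

section Divergence

variable {d : Type*} [Fintype d] [DecidableEq d]

theorem Diagonalizes.power {U A : Matrix d d ℂ} {a : d → ℝ} (h : Diagonalizes U a A) (s : ℝ) :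
    Diagonalizes U (fun i => a i ^ s) (power A s) :=
  h.map fun t => t ^ s

theorem IsDensity.sum_eq_one {ρ U : Matrix d d ℂ} {a : d → ℝ} (hρ : IsDensity ρ)
    (hU : Diagonalizes U a ρ) : ∑ i, a i = 1 := by
  have h := hU.trace_eq
  rw [hρ.2] at h
  exact_mod_cast h.symm

/-- The support projection of `σ` fixes `ρ`, so deleting the terms with `b j = 0` leaves the trace
unchanged; being nonnegative, the deleted terms vanish. This makes the values of `log` and negative
powers at `0` harmless. -/
theorem SuppLE.overlap_mul_eq_zero {ρ σ U V : Matrix d d ℂ} {a b : d → ℝ} (h : SuppLE ρ σ)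
    (hρ : ρ.PosSemidef) (hU : Diagonalizes U a ρ) (hV : Diagonalizes V b σ) (i j : d)
    (hj : b j = 0) : overlap U V i j * a i = 0 := by
  have h1 := h.mul_cfc hV.isHermitian (g := fun t => if t = 0 then 0 else 1)
    fun t _ ht => if_neg ht
  have h2 := hU.trace_mul (hV.map fun t => if t = 0 then 0 else 1)
  have h3 := hU.trace_mul (diagonalizes_one hV.left_inv)
  rw [h1] at h2
  rw [Matrix.mul_one, h2] at h3
  have h4 := Complex.ofReal_injective h3
  have h5 : ∑ i, ∑ j, (overlap U V i j * a i * 1 -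
      overlap U V i j * a i * (if b j = 0 then 0 else 1)) = 0 := by
    simp only [Finset.sum_sub_distrib]
    exact sub_eq_zero.2 h4.symm
  have hnn : ∀ i j, 0 ≤ overlap U V i j * a i * 1 -
      overlap U V i j * a i * (if b j = 0 then 0 else 1) := by
    intro i j
    have := mul_nonneg (overlap_nonneg U V i j) (hU.nonneg hρ i)
    split_ifs <;> linarith
  have h6 := (Finset.sum_eq_zero_iff_of_nonneg fun i _ => Finset.sum_nonneg fun j _ => hnn i j).1 h5
    i (Finset.mem_univ i)
  have h7 := (Finset.sum_eq_zero_iff_of_nonneg fun j _ => hnn i j).1 h6 j (Finset.mem_univ j)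
  simpa [hj] using h7

/-- `Tr[ρ (log ρ - log σ)]`. -/
def relEntropyReal (ρ σ : Matrix d d ℂ) : ℝ := (ρ * (logarithm ρ - logarithm σ)).trace.re

theorem relEntropyReal_eq {ρ σ U V : Matrix d d ℂ} {a b : d → ℝ} (hU : Diagonalizes U a ρ)
    (hV : Diagonalizes V b σ) :
    relEntropyReal ρ σ = ∑ i, ∑ j, overlap U V i j * a i * (Real.log (a i) - Real.log (b j)) := by
  have h1 : (ρ * logarithm ρ).trace.re = ∑ i, ∑ j, overlap U V i j * a i * Real.log (a i) := by
    rw [logarithm, (hU.mul (hU.map Real.log)).trace_eq, Complex.ofReal_re]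
    refine Finset.sum_congr rfl fun i _ => ?_
    simp_rw [mul_assoc]
    rw [← Finset.sum_mul, sum_overlap_right hU.left_inv hV.left_inv, one_mul]
  have h2 : (ρ * logarithm σ).trace.re = ∑ i, ∑ j, overlap U V i j * a i * Real.log (b j) := by
    rw [logarithm, hU.trace_mul (hV.map Real.log), Complex.ofReal_re]
  rw [relEntropyReal, Matrix.mul_sub, Matrix.trace_sub, Complex.sub_re, h1, h2]
  simp_rw [mul_sub, Finset.sum_sub_distrib]

/-- Klein's inequality: termwise comparison with `∑ overlap * (a i - b j)`, which is `0` as both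
traces are `1`, through `log t ≤ t - 1`. -/
theorem relEntropyReal_nonneg {ρ σ : Matrix d d ℂ} (hρ : IsDensity ρ) (hσ : IsDensity σ)
    (h : SuppLE ρ σ) : 0 ≤ relEntropyReal ρ σ := by
  obtain ⟨U, a, hU⟩ := exists_diagonalizes hρ.1.isHermitian
  obtain ⟨V, b, hV⟩ := exists_diagonalizes hσ.1.isHermitian
  rw [relEntropyReal_eq hU hV]
  have h0 : ∑ i, ∑ j, overlap U V i j * (a i - b j) = 0 := by
    simp_rw [mul_sub, Finset.sum_sub_distrib]
    rw [Finset.sum_comm (f := fun i j => overlap U V i j * b j)]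
    simp_rw [← Finset.sum_mul, sum_overlap_right hU.left_inv hV.left_inv,
      sum_overlap_left hU.left_inv hV.left_inv, one_mul, hρ.sum_eq_one hU, hσ.sum_eq_one hV,
      sub_self]
  rw [← h0]
  refine Finset.sum_le_sum fun i _ => Finset.sum_le_sum fun j _ => ?_
  have hw := overlap_nonneg U V i j
  have hb := hV.nonneg hσ.1 j
  rcases (hU.nonneg hρ.1 i).eq_or_lt with ha | ha
  · rw [← ha]
    simp only [mul_zero, zero_mul, zero_sub]
    nlinarith
  rcases hb.eq_or_lt with hb' | hb'
  · have := h.overlap_mul_eq_zero hρ.1 hU hV i j hb'.symm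
    rw [this, ← hb', sub_zero, this, zero_mul]
  · rw [mul_assoc]
    refine mul_le_mul_of_nonneg_left ?_ hw
    have h1 := Real.log_le_sub_one_of_pos (div_pos hb' ha)
    rw [Real.log_div hb'.ne' ha.ne'] at h1
    have h2 : a i * (Real.log (b j) - Real.log (a i)) ≤ a i * (b j / a i - 1) :=
      mul_le_mul_of_nonneg_left h1 ha.le
    have h3 : a i * (b j / a i - 1) = b j - a i := by field_simp
    linarith

theorem sandwichedQ_eq {ρ σ : Matrix d d ℂ} (hρ : ρ.IsHermitian) (hσ : σ.IsHermitian) {α : ℝ}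
    (hα : 0 < α) : sandwichedQ α ρ σ =
      absMoment α (power σ ((1 - α) / (2 * α)) * ρ * power σ ((1 - α) / (2 * α))) := by
  have hH := isHermitian_conj hρ (isHermitian_cfc hσ fun t : ℝ => t ^ ((1 - α) / (2 * α)))
  have h := schattenNorm_eq hH α
  rw [sandwichedQ, power, h, ← Real.rpow_mul (absMoment_nonneg hH _), one_div_mul_cancel hα.ne',
    Real.rpow_one]

theorem power_half_mul_self {ρ : Matrix d d ℂ} (hρ : ρ.PosSemidef) :
    power ρ (1 / 2) * power ρ (1 / 2) = ρ := by
  rw [power, cfc_mul_cfc hρ.isHermitian]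
  conv_rhs => rw [← cfc_id' ℝ ρ hρ.isHermitian.isSelfAdjoint]
  refine cfc_congr fun t ht => ?_
  have := spectrum_nonneg hρ ht
  rw [← Real.rpow_add_of_nonneg this (by norm_num) (by norm_num)]
  norm_num

/-- Swaps the order in `X = σ ^ ((1 - α) / (2 α)) ρ ^ (1 / 2)`: the operator now lies between two
copies of `ρ ^ (1 / 2)`, ready to be paired with, or compared to, powers of `ρ`. -/
theorem sandwichedQ_eq' {ρ σ : Matrix d d ℂ} (hρ : ρ.PosSemidef) (hσ : σ.IsHermitian) {α : ℝ}
    (hα : 0 < α) : sandwichedQ α ρ σ =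
      absMoment α (power ρ (1 / 2) * (power σ ((1 - α) / (2 * α)) * power σ ((1 - α) / (2 * α))) *
        power ρ (1 / 2)) := by
  rw [sandwichedQ_eq hρ.isHermitian hσ hα]
  set K := power σ ((1 - α) / (2 * α))
  set S := power ρ (1 / 2) with hS
  have hKH : K.IsHermitian := isHermitian_cfc hσ _
  have hSH : S.IsHermitian := isHermitian_cfc hρ.isHermitian _
  have h0 : |(0 : ℝ)| ^ α = 0 := by rw [abs_zero, Real.zero_rpow hα.ne']
  have h := trace_cfc_mul_conjTranspose (K * S) (f := fun t : ℝ => |t| ^ α) h0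
  rw [Matrix.conjTranspose_mul, hKH.eq, hSH.eq] at h
  have e1 : K * S * (S * K) = K * ρ * K := by
    rw [← power_half_mul_self hρ]; simp only [Matrix.mul_assoc, ← hS]
  have e2 : S * K * (K * S) = S * (K * K) * S := by simp only [Matrix.mul_assoc]
  rw [e1, e2] at h
  rw [absMoment, absMoment, h]

/-- The diagonal form of `Tr[ρ ^ (1 / 2) σ ^ (-2r) ρ ^ (1 / 2) ρ ^ t]`. -/
theorem trace_conj_power_mul_power {ρ σ U V : Matrix d d ℂ} {a b : d → ℝ} (h : SuppLE ρ σ)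
    (hρ : ρ.PosSemidef) (hσ : σ.PosSemidef) (hU : Diagonalizes U a ρ) (hV : Diagonalizes V b σ)
    (r t : ℝ) :
    (power ρ (1 / 2) * (power σ (-r) * power σ (-r)) * power ρ (1 / 2) * power ρ t).trace.re =
      ∑ i, ∑ j, overlap U V i j * a i *
        Real.exp (t * Real.log (a i) - 2 * r * Real.log (b j)) := by
  have h1 : (power ρ (1 / 2) * (power σ (-r) * power σ (-r)) * power ρ (1 / 2) *
      power ρ t).trace = (power ρ (1 / 2) * power ρ t * power ρ (1 / 2) *
        (power σ (-r) * power σ (-r))).trace := by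
    rw [Matrix.mul_assoc, Matrix.mul_assoc, Matrix.trace_mul_comm,
      Matrix.trace_mul_comm _ (power σ (-r) * power σ (-r))]
    simp only [Matrix.mul_assoc]
  have hUp : ∀ s : ℝ, Diagonalizes U (fun i => a i ^ s) (power ρ s) := hU.power
  have hVp : ∀ s : ℝ, Diagonalizes V (fun i => b i ^ s) (power σ s) := hV.power
  rw [h1, (((hUp _).mul (hUp _)).mul (hUp _)).trace_mul ((hVp _).mul (hVp _)), Complex.ofReal_re]
  refine Finset.sum_congr rfl fun i _ => Finset.sum_congr rfl fun j _ => ?_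
  -- Only pairs with `a i > 0` and nonzero overlap carry weight; there `b j > 0` by the support
  -- condition, and powers are exponentials of logarithms.
  rcases (hU.nonneg hρ i).eq_or_lt with ha | ha
  · rw [← ha, Real.zero_rpow (by norm_num : (1 / 2 : ℝ) ≠ 0)]
    simp
  by_cases hw : overlap U V i j = 0
  · simp [hw]
  have hb : 0 < b j := by
    refine lt_of_le_of_ne (hV.nonneg hσ j) fun hb => ?_
    rcases mul_eq_zero.1 (h.overlap_mul_eq_zero hρ hU hV i j hb.symm) with h | h
    · exact hw h
    · exact ha.ne' h
  have e1 : a i ^ (1 / 2 : ℝ) * a i ^ t * a i ^ (1 / 2 : ℝ) = a i * Real.exp (t * Real.log (a i)) := by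
    have : a i ^ (1 / 2 : ℝ) * a i ^ (1 / 2 : ℝ) = a i := by
      rw [← Real.rpow_add ha]; norm_num
    rw [Real.rpow_def_of_pos ha t, mul_comm (Real.log _) t]
    linear_combination Real.exp (t * Real.log (a i)) * this
  have e2 : b j ^ (-r) * b j ^ (-r) = Real.exp (-(2 * r * Real.log (b j))) := by
    rw [← Real.rpow_add hb, Real.rpow_def_of_pos hb]
    ring_nf
  rw [e1, e2, sub_eq_add_neg, Real.exp_add]
  ring

/-- Weights of the joint distribution attached to two states. -/
theorem sum_overlap_mul_eq_one {ρ σ U V : Matrix d d ℂ} {a b : d → ℝ} (hρ : IsDensity ρ)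
    (hU : Diagonalizes U a ρ) (hV : Diagonalizes V b σ) :
    ∑ k : d × d, overlap U V k.1 k.2 * a k.1 = 1 := by
  rw [Fintype.sum_prod_type, ← hρ.sum_eq_one hU]
  refine Finset.sum_congr rfl fun i _ => ?_
  simp only [← Finset.sum_mul]
  rw [sum_overlap_right hU.left_inv hV.left_inv, one_mul]

/-- Hölder against `ρ ^ s`, `s = (α - 1) / α`, whose dual norm is `1`. The pairing is the mean of
`exp (s (log a i - log b j))` under the weights `overlap * a i`, and Jensen moves the mean inside
the exponential. -/
theorem exp_relEntropyReal_le {ρ σ : Matrix d d ℂ} (hρ : IsDensity ρ) (hσ : σ.PosSemidef)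
    (h : SuppLE ρ σ) {α : ℝ} (hα : 1 < α) :
    Real.exp ((α - 1) / α * relEntropyReal ρ σ) ≤ sandwichedQ α ρ σ ^ (1 / α) := by
  obtain ⟨U, a, hU⟩ := exists_diagonalizes hρ.1.isHermitian
  obtain ⟨V, b, hV⟩ := exists_diagonalizes hσ.isHermitian
  have hα0 : 0 < α := by linarith
  have hα1 : α - 1 ≠ 0 := by linarith
  set s := (α - 1) / α with hs
  have hconj : α.HolderConjugate (α / (α - 1)) := Real.HolderConjugate.conjExponent hα
  have hr : (1 - α) / (2 * α) = -(s / 2) := by rw [hs]; field_simp; ring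
  have hC : (power ρ (1 / 2) * (power σ (-(s / 2)) * power σ (-(s / 2))) *
      power ρ (1 / 2)).IsHermitian := by
    refine isHermitian_conj ?_ (isHermitian_cfc hρ.1.isHermitian _)
    rw [power, cfc_mul_cfc hσ.isHermitian]
    exact isHermitian_cfc hσ.isHermitian _
  have hP : (power ρ s).IsHermitian := isHermitian_cfc hρ.1.isHermitian _
  have h1 := re_trace_mul_le hconj hC hP
  have h2 : absMoment (α / (α - 1)) (power ρ s) = 1 := by
    have hUs : Diagonalizes U (fun i => a i ^ s) (power ρ s) := hU.power s
    rw [hUs.absMoment_eq]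
    refine (Finset.sum_congr rfl fun i _ => ?_).trans (hρ.sum_eq_one hU)
    have ha := hU.nonneg hρ.1 i
    have : s * (α / (α - 1)) = 1 := by rw [hs]; field_simp
    rw [abs_of_nonneg (Real.rpow_nonneg ha _), ← Real.rpow_mul ha, this, Real.rpow_one]
  rw [h2, Real.one_rpow, mul_one, trace_conj_power_mul_power h hρ.1 hσ hU hV,
    ← Fintype.sum_prod_type'] at h1
  rw [sandwichedQ_eq' hρ.1 hσ.isHermitian hα0, hr]
  refine le_trans ?_ h1
  have h3 := convexOn_exp.map_sum_le (t := (Finset.univ : Finset (d × d)))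
    (w := fun k => overlap U V k.1 k.2 * a k.1)
    (p := fun k => s * (Real.log (a k.1) - Real.log (b k.2)))
    (fun k _ => mul_nonneg (overlap_nonneg _ _ _ _) (hU.nonneg hρ.1 _))
    (sum_overlap_mul_eq_one hρ hU hV) (fun _ _ => Set.mem_univ _)
  simp only [smul_eq_mul] at h3
  convert h3 using 2
  · rw [relEntropyReal_eq hU hV, ← Fintype.sum_prod_type', Finset.mul_sum]
    exact Finset.sum_congr rfl fun k _ => by ring
  · rw [show s * Real.log (a _) - 2 * (s / 2) * Real.log (b _) =
      s * (Real.log (a _) - Real.log (b _)) by ring]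

theorem sandwichedQ_pos {ρ σ : Matrix d d ℂ} (hρ : IsDensity ρ) (hσ : σ.PosSemidef)
    (h : SuppLE ρ σ) {α : ℝ} (hα : 1 < α) : 0 < sandwichedQ α ρ σ := by
  have h1 := (Real.exp_pos _).trans_le (exp_relEntropyReal_le hρ hσ h hα)
  have hα0 : 0 < α := by linarith
  have h2 : 0 ≤ sandwichedQ α ρ σ := by
    rw [sandwichedQ_eq hρ.1.isHermitian hσ.isHermitian hα0]
    exact absMoment_nonneg
      (isHermitian_conj hρ.1.isHermitian (isHermitian_cfc hσ.isHermitian _)) _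
  refine lt_of_le_of_ne h2 fun h0 => ?_
  rw [← h0, Real.zero_rpow (by positivity)] at h1
  exact lt_irrefl _ h1

/-- The sandwiched Rényi divergence of order `α > 1` dominates the relative entropy. -/
theorem relEntropyReal_le {ρ σ : Matrix d d ℂ} (hρ : IsDensity ρ) (hσ : σ.PosSemidef)
    (h : SuppLE ρ σ) {α : ℝ} (hα : 1 < α) :
    relEntropyReal ρ σ ≤ 1 / (α - 1) * Real.log (sandwichedQ α ρ σ) := by
  have hα0 : 0 < α := by linarith
  have hα1 : 0 < α - 1 := by linarith
  have h1 := Real.log_le_log (Real.exp_pos _) (exp_relEntropyReal_le hρ hσ h hα)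
  rw [Real.log_exp, Real.log_rpow (sandwichedQ_pos hρ hσ h hα)] at h1
  have h2 := mul_le_mul_of_nonneg_left h1 (by positivity : 0 ≤ α / (α - 1))
  have e1 : ∀ t : ℝ, α / (α - 1) * ((α - 1) / α * t) = t := fun t => by
    have := hα1.ne'
    field_simp
  have e2 : ∀ t : ℝ, α / (α - 1) * (1 / α * t) = 1 / (α - 1) * t := fun t => by
    have := hα1.ne'
    field_simp
  rwa [e1, e2] at h2

open scoped Matrix.Norms.L2Operator MatrixOrder in
/-- The Löwner–Heinz inequality. -/
theorem posSemidef_power_sub_power {A B : Matrix d d ℂ} (hA : A.PosSemidef) (hB : B.PosSemidef)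
    (h : (B - A).PosSemidef) {t : ℝ} (ht : t ∈ Set.Icc (0 : ℝ) 1) :
    (power B t - power A t).PosSemidef := by
  have h1 : A ≤ B := h
  have h2 := CFC.rpow_le_rpow ht h1
  rw [CFC.rpow_eq_cfc_real hA.nonneg, CFC.rpow_eq_cfc_real hB.nonneg] at h2
  exact h2

theorem re_trace_mul_nonneg {A B : Matrix d d ℂ} (hA : A.PosSemidef) (hB : B.PosSemidef) :
    0 ≤ (A * B).trace.re := by
  obtain ⟨U, a, hU⟩ := exists_diagonalizes hA.isHermitian
  obtain ⟨V, b, hV⟩ := exists_diagonalizes hB.isHermitian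
  rw [hU.trace_mul hV, Complex.ofReal_re]
  exact Finset.sum_nonneg fun i _ => Finset.sum_nonneg fun j _ =>
    mul_nonneg (mul_nonneg (overlap_nonneg _ _ _ _) (hU.nonneg hA i)) (hV.nonneg hB j)

/-- Let `C = ρ ^ (1 / 2) N ρ ^ (1 / 2)` with `N` the power `-s` of `σ` on its support. As `N ≤ l ^
(-s)`, `C ≤ l ^ (-s) ρ`, and Löwner–Heinz with exponent `α - 1 ≤ 1` bounds `C ^ (α - 1)`. Only this
one factor of `C ^ α` is replaced, so the error `l ^ (-s (α - 1))` is of second order in `α - 1`. -/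
theorem sandwichedQ_le {ρ σ U V : Matrix d d ℂ} {a b : d → ℝ} (hρ : ρ.PosSemidef)
    (hσ : σ.PosSemidef) (h : SuppLE ρ σ) (hU : Diagonalizes U a ρ) (hV : Diagonalizes V b σ)
    {l : ℝ} (hl : 0 < l) (hb : ∀ j, b j ≠ 0 → l ≤ b j) {α : ℝ} (hα : 1 < α) (hα2 : α < 2) :
    sandwichedQ α ρ σ ≤ l ^ (-((α - 1) / α * (α - 1))) *
      ∑ k : d × d, overlap U V k.1 k.2 * a k.1 *
        Real.exp ((α - 1) * Real.log (a k.1) - (α - 1) / α * Real.log (b k.2)) := by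
  have hα0 : 0 < α := by linarith
  have hα1 : α - 1 ≠ 0 := by linarith
  set s := (α - 1) / α with hs
  have hs0 : 0 < s := div_pos (by linarith) hα0
  have hr : (1 - α) / (2 * α) = -(s / 2) := by rw [hs]; field_simp; ring
  rw [sandwichedQ_eq' hρ hσ.isHermitian hα0, hr]
  have htr := trace_conj_power_mul_power h hρ hσ hU hV (s / 2) (α - 1)
  rw [← Fintype.sum_prod_type', show 2 * (s / 2) = s by ring] at htr
  rw [← htr]
  set R := power ρ (1 / 2) with hR
  have hRH : R.IsHermitian := isHermitian_cfc hρ.isHermitian _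
  have hRU : Diagonalizes U (fun i => a i ^ (1 / 2 : ℝ)) R := hU.power _
  have hVK : Diagonalizes V (fun i => b i ^ (-(s / 2))) (power σ (-(s / 2))) := hV.power _
  set N := power σ (-(s / 2)) * power σ (-(s / 2)) with hN
  have hVN := hVK.mul hVK
  rw [← hN] at hVN
  have hNp : N.PosSemidef := hVN.posSemidef fun i => mul_self_nonneg _
  have hCp : (R * N * R).PosSemidef := posSemidef_conj hNp hRH
  have hκ : 0 < l ^ (-s) := Real.rpow_pos_of_pos hl _
  have hρκ : (((l ^ (-s) : ℝ) : ℂ) • ρ).PosSemidef :=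
    (hU.smul _).posSemidef fun i => mul_nonneg hκ.le (hU.nonneg hρ i)
  have hdiff : (((l ^ (-s) : ℝ) : ℂ) • ρ - R * N * R).PosSemidef := by
    have h1 : (((l ^ (-s) : ℝ) : ℂ) • (1 : Matrix d d ℂ) - N).PosSemidef := by
      have h2 : ((l ^ (-s) : ℝ) : ℂ) • (1 : Matrix d d ℂ) - N =
          cfc (fun t : ℝ => l ^ (-s) - t ^ (-(s / 2)) * t ^ (-(s / 2))) σ := by
        rw [(hV.map _).eq, hVN.eq, ((diagonalizes_one hV.left_inv).smul _).eq, ← Matrix.sub_mul,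
          ← Matrix.mul_sub, Matrix.diagonal_sub]
        simp
      rw [h2]
      refine (hV.map _).posSemidef fun j => ?_
      by_cases hj : b j = 0
      · rw [hj, Real.zero_rpow (by linarith : -(s / 2) ≠ 0)]
        simpa using hκ.le
      · have hbj : 0 < b j := hl.trans_le (hb j hj)
        rw [← Real.rpow_add hbj, sub_nonneg, show -(s / 2) + -(s / 2) = -s by ring]
        exact Real.rpow_le_rpow_of_nonpos hl (hb j hj) (by linarith)
    have h3 := posSemidef_conj h1 hRH
    convert h3 using 1
    rw [Matrix.mul_sub, Matrix.sub_mul, Matrix.mul_smul, Matrix.smul_mul, Matrix.mul_one,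
      power_half_mul_self hρ]
  have hLH := posSemidef_power_sub_power hCp hρκ hdiff (t := α - 1) ⟨by linarith, by linarith⟩
  have hpow : power (((l ^ (-s) : ℝ) : ℂ) • ρ) (α - 1) =
      ((l ^ (-(s * (α - 1))) : ℝ) : ℂ) • power ρ (α - 1) := by
    have hUp : Diagonalizes U (fun i => a i ^ (α - 1)) (power ρ (α - 1)) := hU.power _
    refine ((hU.smul _).power _).unique ?_
    convert hUp.smul _ using 2 with i
    rw [Real.mul_rpow hκ.le (hU.nonneg hρ i), ← Real.rpow_mul hl.le, neg_mul]
  rw [hpow] at hLH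
  have h4 := re_trace_mul_nonneg hCp hLH
  rw [Matrix.mul_sub, Matrix.trace_sub, Complex.sub_re, Matrix.mul_smul, Matrix.trace_smul,
    smul_eq_mul, Complex.re_ofReal_mul] at h4
  have h5 : (R * N * R * power (R * N * R) (α - 1)).trace.re = absMoment α (R * N * R) := by
    obtain ⟨W, c, hW⟩ := exists_diagonalizes hCp.isHermitian
    have hWp : Diagonalizes W (fun i => c i ^ (α - 1)) (power (R * N * R) (α - 1)) := hW.power _
    rw [hW.absMoment_eq, (hW.mul hWp).trace_eq, Complex.ofReal_re]
    refine Finset.sum_congr rfl fun i _ => ?_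
    have hc := hW.nonneg hCp i
    rw [abs_of_nonneg hc]
    rcases hc.eq_or_lt with hc | hc
    · rw [← hc, Real.zero_rpow hα0.ne', zero_mul]
    · rw [Real.rpow_sub_one hc.ne']
      field_simp
  rw [h5] at h4
  linarith

theorem exists_sandwichedQ_lt {ρ σ : Matrix d d ℂ} (hρ : IsDensity ρ) (hσ : σ.PosSemidef)
    (h : SuppLE ρ σ) {R : ℝ} (hR : relEntropyReal ρ σ < R) :
    ∃ α ∈ Set.Ioo (1 : ℝ) 2, 1 / (α - 1) * Real.log (sandwichedQ α ρ σ) < R := by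
  obtain ⟨U, a, hU⟩ := exists_diagonalizes hρ.1.isHermitian
  obtain ⟨V, b, hV⟩ := exists_diagonalizes hσ.isHermitian
  obtain ⟨l, hl, hb⟩ : ∃ l : ℝ, 0 < l ∧ ∀ j, b j ≠ 0 → l ≤ b j := by
    by_cases hne : (Finset.univ.filter fun j => b j ≠ 0).Nonempty
    · obtain ⟨j, hj, hmin⟩ := Finset.exists_min_image _ b hne
      refine ⟨b j, lt_of_le_of_ne (hV.nonneg hσ j) (Ne.symm (Finset.mem_filter.1 hj).2), ?_⟩
      exact fun k hk => hmin k (Finset.mem_filter.2 ⟨Finset.mem_univ k, hk⟩)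
    -- With no nonzero eigenvalue the condition is void and any positive number serves.
    · refine ⟨1, one_pos, fun j hj => (hne ⟨j, ?_⟩).elim⟩
      exact Finset.mem_filter.2 ⟨Finset.mem_univ j, hj⟩
  set w : d × d → ℝ := fun k => overlap U V k.1 k.2 * a k.1 with hw
  set x : d × d → ℝ := fun k => Real.log (a k.1) with hx
  set y : d × d → ℝ := fun k => Real.log (b k.2) with hy
  have hw0 : ∀ k, 0 ≤ w k := fun k => mul_nonneg (overlap_nonneg _ _ _ _) (hU.nonneg hρ.1 _)
  have hw1 : ∑ k, w k = 1 := sum_overlap_mul_eq_one hρ hU hV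
  have hD : relEntropyReal ρ σ = ∑ k, w k * (x k - y k) := by
    rw [relEntropyReal_eq hU hV, ← Fintype.sum_prod_type']
  set G : ℝ → ℝ := fun α => ∑ k, w k * Real.exp ((α - 1) * x k - (α - 1) / α * y k) with hG
  have hG1 : G 1 = 1 := by simp [hG, hw1]
  have hGpos : ∀ α, 0 < G α := by
    intro α
    refine lt_of_le_of_ne (Finset.sum_nonneg fun k _ => mul_nonneg (hw0 k) (Real.exp_pos _).le) ?_
    intro h0
    have h1 := (Finset.sum_eq_zero_iff_of_nonneg fun k _ =>
      mul_nonneg (hw0 k) (Real.exp_pos _).le).1 h0.symm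
    have h2 : ∑ k, w k = 0 := Finset.sum_eq_zero fun k hk =>
      (mul_eq_zero.1 (h1 k hk)).resolve_right (Real.exp_pos _).ne'
    rw [hw1] at h2
    exact one_ne_zero h2
  have hs' : HasDerivAt (fun α : ℝ => (α - 1) / α) 1 1 := by
    have := ((hasDerivAt_id' (1 : ℝ)).sub_const 1).fun_div (hasDerivAt_id' (1 : ℝ)) one_ne_zero
    simpa using this
  have hsub : HasDerivAt (fun α : ℝ => α - 1) 1 1 := (hasDerivAt_id (1 : ℝ)).sub_const 1
  have hG' : HasDerivAt G (∑ k, w k * (x k - y k)) 1 := by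
    refine HasDerivAt.fun_sum fun k _ => ?_
    have := (((hsub.mul_const (x k)).sub (hs'.mul_const (y k))).exp).const_mul (w k)
    simpa using this
  -- The logarithm of the upper bound on `sandwichedQ`. The `log l` term has a double zero at `1`,
  -- so `H` vanishes there with derivative `relEntropyReal ρ σ`; hence its slope is below `R` just
  -- to the right of `1`.
  set H : ℝ → ℝ := fun α => -((α - 1) / α * (α - 1)) * Real.log l + Real.log (G α) with hH
  have hH' : HasDerivAt H (∑ k, w k * (x k - y k)) 1 := by
    have h1 := ((hs'.fun_mul hsub).fun_neg.mul_const (Real.log l)).fun_add (hG'.log (hGpos 1).ne')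
    exact h1.congr_deriv (by simp [hG1])
  have hH1 : H 1 = 0 := by simp [hH, hG1]
  have htend := hasDerivAt_iff_tendsto_slope.1 hH'
  rw [← hD] at htend
  have htend' := htend.mono_left
    (nhdsWithin_mono (1 : ℝ) (fun t (ht : t ∈ Set.Ioi (1 : ℝ)) => (ne_of_gt ht : t ≠ 1)))
  have hev := htend'.eventually (gt_mem_nhds hR)
  have hev2 : ∀ᶠ α in nhdsWithin (1 : ℝ) (Set.Ioi 1), α ∈ Set.Ioo (1 : ℝ) 2 :=
    Ioo_mem_nhdsGT one_lt_two
  obtain ⟨α, hα, hαI⟩ := (hev.and hev2).exists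
  refine ⟨α, hαI, lt_of_le_of_lt ?_ hα⟩
  have hα1 : 0 < α - 1 := sub_pos.2 hαI.1
  rw [slope_def_field, hH1, sub_zero, one_div, div_eq_inv_mul (H α)]
  refine mul_le_mul_of_nonneg_left ?_ (inv_nonneg.2 hα1.le)
  have hle := sandwichedQ_le hρ.1 hσ h hU hV hl hb hαI.1 hαI.2
  have h2 := Real.log_le_log (sandwichedQ_pos hρ hσ h hαI.1) hle
  refine h2.trans_eq ?_
  have hGα := hGpos α
  rw [Real.log_mul (Real.rpow_pos_of_pos hl _).ne' hGα.ne', Real.log_rpow hl]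

end Divergence

/-! ### Classical-quantum states as block-diagonal matrices -/

section ClassicalQuantumStates

variable {X d : Type*} [Fintype X] [DecidableEq X] [Fintype d] [DecidableEq d]

/-- The block-diagonal matrix `∑ x, |x⟩⟨x| ⊗ A x`. -/
def block (A : X → Matrix d d ℂ) : Matrix (X × d) (X × d) ℂ :=
  Matrix.of fun i j => if i.1 = j.1 then A i.1 i.2 j.2 else 0

theorem block_mul (A B : X → Matrix d d ℂ) : block A * block B = block fun x => A x * B x := by
  ext ⟨x, i⟩ ⟨y, j⟩
  simp only [block, Matrix.mul_apply, Matrix.of_apply, Fintype.sum_prod_type]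
  rw [Finset.sum_eq_single x]
  · by_cases h : x = y
    · subst h; simp
    · simp [h]
  · intro z _ hz
    simp [hz.symm]
  · simp

theorem block_sub (A B : X → Matrix d d ℂ) : block A - block B = block fun x => A x - B x := by
  ext ⟨x, i⟩ ⟨y, j⟩
  by_cases h : x = y <;> simp [block, h]

theorem block_conjTranspose (A : X → Matrix d d ℂ) : (block A)ᴴ = block fun x => (A x)ᴴ := by
  ext ⟨x, i⟩ ⟨y, j⟩
  by_cases h : x = y
  · subst h; simp [block, Matrix.conjTranspose_apply]
  · simp [block, Matrix.conjTranspose_apply, h, Ne.symm h]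

theorem block_diagonal (a : X → d → ℂ) :
    (block fun x => Matrix.diagonal (a x)) = Matrix.diagonal fun i => a i.1 i.2 := by
  ext ⟨x, i⟩ ⟨y, j⟩
  by_cases h : x = y
  · subst h
    by_cases h : i = j
    · subst h; simp [block]
    · simp [block, h]
  · simp [block, h]

theorem block_one : (block fun _ : X => (1 : Matrix d d ℂ)) = 1 := by
  have h := block_diagonal (X := X) (d := d) fun _ _ => 1
  simpa using h

theorem trace_block (A : X → Matrix d d ℂ) : (block A).trace = ∑ x, (A x).trace := by
  simp [block, Matrix.trace, Fintype.sum_prod_type]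

theorem block_mulVec (A : X → Matrix d d ℂ) (v : X × d → ℂ) (x : X) (i : d) :
    (block A *ᵥ v) (x, i) = (A x *ᵥ fun j => v (x, j)) i := by
  simp only [block, Matrix.mulVec, dotProduct, Matrix.of_apply, Fintype.sum_prod_type]
  rw [Finset.sum_eq_single x]
  · simp
  · intro z _ hz
    simp [hz.symm]
  · simp

theorem suppLE_block_iff {A B : X → Matrix d d ℂ} :
    SuppLE (block A) (block B) ↔ ∀ x, SuppLE (A x) (B x) := by
  constructor
  · intro h x v hv
    have h1 := h (fun i => if i.1 = x then v i.2 else 0) (by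
      ext ⟨y, i⟩
      rw [block_mulVec]
      by_cases hy : y = x
      · subst hy; simp [hv]
      · simp [hy, Matrix.mulVec, dotProduct])
    ext i
    have h2 := congrFun h1 (x, i)
    rw [block_mulVec] at h2
    simpa using h2
  · intro h v hv
    ext ⟨x, i⟩
    rw [block_mulVec, h x _ ?_]
    · rfl
    · ext j
      have := congrFun hv (x, j)
      rw [block_mulVec] at this
      exact this

theorem Diagonalizes.block {U A : X → Matrix d d ℂ} {a : X → d → ℝ}
    (h : ∀ x, Diagonalizes (U x) (a x) (A x)) :
    Diagonalizes (block U) (fun i => a i.1 i.2) (block A) := by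
  refine ⟨?_, ?_⟩
  · rw [block_conjTranspose, block_mul]
    simp only [(h _).left_inv, block_one]
  · rw [← block_diagonal fun x i => (a x i : ℂ), block_conjTranspose, block_mul, block_mul]
    congr 1
    ext1 x
    exact (h x).eq

theorem cfc_block {A : X → Matrix d d ℂ} (hA : ∀ x, (A x).IsHermitian) (f : ℝ → ℝ) :
    cfc f (block A) = block fun x => cfc f (A x) := by
  choose U a h using fun x => exists_diagonalizes (hA x)
  exact ((Diagonalizes.block h).map f).unique (Diagonalizes.block fun x => (h x).map f)

theorem isHermitian_block {A : X → Matrix d d ℂ} (hA : ∀ x, (A x).IsHermitian) :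
    (block A).IsHermitian := by
  rw [Matrix.IsHermitian, block_conjTranspose]
  simp only [(hA _).eq]

theorem posSemidef_block {A : X → Matrix d d ℂ} (hA : ∀ x, (A x).PosSemidef) :
    (block A).PosSemidef := by
  choose U a h using fun x => exists_diagonalizes (hA x).isHermitian
  exact (Diagonalizes.block h).posSemidef fun i => (h i.1).nonneg (hA i.1) i.2

theorem absMoment_block {A : X → Matrix d d ℂ} (hA : ∀ x, (A x).IsHermitian) (q : ℝ) :
    absMoment q (block A) = ∑ x, absMoment q (A x) := by
  rw [absMoment, cfc_block hA, trace_block, Complex.re_sum]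
  rfl

theorem relEntropyReal_block {A B : X → Matrix d d ℂ} (hA : ∀ x, (A x).IsHermitian)
    (hB : ∀ x, (B x).IsHermitian) :
    relEntropyReal (block A) (block B) = ∑ x, relEntropyReal (A x) (B x) := by
  rw [relEntropyReal, logarithm, logarithm, cfc_block hA, cfc_block hB, block_sub, block_mul,
    trace_block, Complex.re_sum]
  rfl

theorem cqState_eq_block (p : X → ℝ) (ρ : X → Matrix d d ℂ) :
    cqState p ρ = block fun x => (p x : ℂ) • ρ x := by
  ext ⟨x, i⟩ ⟨y, j⟩
  simp only [cqState, block, Matrix.sum_apply, Matrix.smul_apply, Matrix.kroneckerMap_apply,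
    Matrix.of_apply, Matrix.single_apply, smul_eq_mul]
  by_cases h : x = y
  · subst h; simp
  · rw [if_neg h]
    refine Finset.sum_eq_zero fun z _ => ?_
    rw [if_neg fun hz => h (hz.1.symm.trans hz.2)]
    simp

theorem classicalState_kronecker_eq_block (p : X → ℝ) (σ : Matrix d d ℂ) :
    classicalState p ⊗ₖ σ = block fun x => (p x : ℂ) • σ := by
  ext ⟨x, i⟩ ⟨y, j⟩
  simp only [classicalState, block, Matrix.sum_apply, Matrix.smul_apply, Matrix.kroneckerMap_apply,
    Matrix.of_apply, Matrix.single_apply, smul_eq_mul]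
  by_cases h : x = y
  · subst h; simp
  · rw [if_neg h, Finset.sum_eq_zero, zero_mul]
    intro z _
    rw [if_neg fun hz => h (hz.1.symm.trans hz.2), mul_zero]

theorem posSemidef_smul {A : Matrix d d ℂ} (hA : A.PosSemidef) {c : ℝ} (hc : 0 ≤ c) :
    ((c : ℂ) • A).PosSemidef := by
  obtain ⟨U, a, h⟩ := exists_diagonalizes hA.isHermitian
  exact (h.smul c).posSemidef fun i => mul_nonneg hc (h.nonneg hA i)

theorem isHermitian_power {A : Matrix d d ℂ} (hA : A.IsHermitian) (s : ℝ) :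
    (power A s).IsHermitian :=
  isHermitian_cfc hA _

theorem power_smul {A : Matrix d d ℂ} (hA : A.PosSemidef) {c : ℝ} (hc : 0 ≤ c) (s : ℝ) :
    power ((c : ℂ) • A) s = ((c ^ s : ℝ) : ℂ) • power A s := by
  obtain ⟨U, a, h⟩ := exists_diagonalizes hA.isHermitian
  refine ((h.smul c).power s).unique ?_
  convert (h.power s).smul (c ^ s) using 2 with i
  exact Real.mul_rpow hc (h.nonneg hA i)

/-- The two copies of `log c` cancel on every pair of eigenvectors carrying weight; the support
condition rules out `log 0` there. -/
theorem relEntropyReal_smul {ρ σ : Matrix d d ℂ} (hρ : ρ.PosSemidef) (hσ : σ.PosSemidef)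
    {c : ℝ} (hc : 0 ≤ c) (h : c ≠ 0 → SuppLE ρ σ) :
    relEntropyReal ((c : ℂ) • ρ) ((c : ℂ) • σ) = c * relEntropyReal ρ σ := by
  rcases hc.eq_or_lt with h0 | h0
  · rw [← h0, relEntropyReal]
    simp
  obtain ⟨U, a, hU⟩ := exists_diagonalizes hρ.isHermitian
  obtain ⟨V, b, hV⟩ := exists_diagonalizes hσ.isHermitian
  rw [relEntropyReal_eq (hU.smul c) (hV.smul c), relEntropyReal_eq hU hV, Finset.mul_sum]
  refine Finset.sum_congr rfl fun i _ => ?_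
  rw [Finset.mul_sum]
  refine Finset.sum_congr rfl fun j _ => ?_
  by_cases hz : overlap U V i j * a i = 0
  · rw [hz, mul_left_comm, hz]
    simp
  have ha : a i ≠ 0 := fun h => hz (by rw [h, mul_zero])
  have hb : b j ≠ 0 := fun hb => hz ((h h0.ne').overlap_mul_eq_zero hρ hU hV i j hb)
  rw [Real.log_mul h0.ne' ha, Real.log_mul h0.ne' hb]
  ring

variable {p : X → ℝ} {ρ : X → Matrix d d ℂ} {σ : Matrix d d ℂ}

theorem suppLE_cqState_iff :
    SuppLE (cqState p ρ) (classicalState p ⊗ₖ σ) ↔ ∀ x, p x ≠ 0 → SuppLE (ρ x) σ := by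
  rw [cqState_eq_block, classicalState_kronecker_eq_block, suppLE_block_iff]
  refine forall_congr' fun x => ⟨fun h hx v hv => ?_, fun h v hv => ?_⟩
  · have h1 := h v (by rw [Matrix.smul_mulVec, hv, smul_zero])
    rw [Matrix.smul_mulVec] at h1
    exact (smul_eq_zero.1 h1).resolve_left (by exact_mod_cast hx)
  · by_cases hx : p x = 0
    · simp [hx]
    · rw [Matrix.smul_mulVec] at hv ⊢
      rw [h hx v ((smul_eq_zero.1 hv).resolve_left (by exact_mod_cast hx)), smul_zero]

theorem isDensity_cqState (hp : p ∈ stdSimplex ℝ X) (hρ : ∀ x, IsDensity (ρ x)) :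
    IsDensity (cqState p ρ) := by
  rw [cqState_eq_block]
  refine ⟨posSemidef_block fun x => posSemidef_smul (hρ x).1 (hp.1 x), ?_⟩
  rw [trace_block]
  simp only [Matrix.trace_smul, (hρ _).2, smul_eq_mul, mul_one]
  exact_mod_cast congrArg (fun t : ℝ => (t : ℂ)) hp.2

theorem posSemidef_classicalState_kronecker (hp : p ∈ stdSimplex ℝ X) (hσ : σ.PosSemidef) :
    (classicalState p ⊗ₖ σ).PosSemidef := by
  rw [classicalState_kronecker_eq_block]
  exact posSemidef_block fun x => posSemidef_smul hσ (hp.1 x)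

theorem isDensity_outputState (hp : p ∈ stdSimplex ℝ X) (hρ : ∀ x, IsDensity (ρ x)) :
    IsDensity (outputState p ρ) := by
  rw [outputState]
  refine ⟨Matrix.posSemidef_sum _ fun x _ => posSemidef_smul (hρ x).1 (hp.1 x), ?_⟩
  rw [Matrix.trace_sum]
  simp only [Matrix.trace_smul, (hρ _).2, smul_eq_mul, mul_one]
  exact_mod_cast congrArg (fun t : ℝ => (t : ℂ)) hp.2

/-- If `ρ_B v = 0`, the expectation of `ρ_B` in `v` is a vanishing sum of nonnegative terms, so each
weighted `ρ x` kills `v`. -/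
theorem suppLE_outputState (hp : p ∈ stdSimplex ℝ X) (hρ : ∀ x, IsDensity (ρ x)) {x : X}
    (hx : p x ≠ 0) : SuppLE (ρ x) (outputState p ρ) := by
  intro v hv
  have h1 : star v ⬝ᵥ (outputState p ρ *ᵥ v) = 0 := by rw [hv, dotProduct_zero]
  rw [outputState, Matrix.sum_mulVec, dotProduct_sum] at h1
  have h2 := (Finset.sum_eq_zero_iff_of_nonneg fun y _ =>
    (posSemidef_smul (hρ y).1 (hp.1 y)).dotProduct_mulVec_nonneg v).1 h1 x (Finset.mem_univ x)
  rw [(posSemidef_smul (hρ x).1 (hp.1 x)).dotProduct_mulVec_zero_iff, Matrix.smul_mulVec] at h2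
  exact (smul_eq_zero.1 h2).resolve_left (by exact_mod_cast hx)

/-- In block `x` the scalar is `p x` to the power `1 + (1 - α) / α = 1 / α`, and the `α`-moment
turns it back into `p x`. This identifies the one-shot bound with the divergence. -/
theorem sandwichedQ_cqState (hp : p ∈ stdSimplex ℝ X) (hρ : ∀ x, (ρ x).PosSemidef)
    (hσ : σ.PosSemidef) {α : ℝ} (hα : 0 < α) :
    sandwichedQ α (cqState p ρ) (classicalState p ⊗ₖ σ) =
      ∑ x, p x * absMoment α (power σ ((1 - α) / (2 * α)) * ρ x *
        power σ ((1 - α) / (2 * α))) := by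
  have h1 : ∀ x, ((p x : ℂ) • ρ x).IsHermitian := fun x => isHermitian_smul (hρ x).isHermitian _
  have h2 : ∀ x, ((p x : ℂ) • σ).IsHermitian := fun x => isHermitian_smul hσ.isHermitian _
  rw [cqState_eq_block, classicalState_kronecker_eq_block,
    sandwichedQ_eq (isHermitian_block h1) (isHermitian_block h2) hα]
  set r := (1 - α) / (2 * α) with hr
  have h3 : power (block fun x => (p x : ℂ) • σ) r = block fun x => power ((p x : ℂ) • σ) r :=
    cfc_block h2 _
  rw [h3, block_mul, block_mul,
    absMoment_block fun x => isHermitian_conj (h1 x) (isHermitian_power (h2 x) _)]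
  refine Finset.sum_congr rfl fun x _ => ?_
  have hH : (power σ r * ρ x * power σ r).IsHermitian :=
    isHermitian_conj (hρ x).isHermitian (isHermitian_cfc hσ.isHermitian _)
  have h4 : power ((p x : ℂ) • σ) r * ((p x : ℂ) • ρ x) * power ((p x : ℂ) • σ) r =
      ((p x ^ r * p x * p x ^ r : ℝ) : ℂ) • (power σ r * ρ x * power σ r) := by
    rw [power_smul hσ (hp.1 x)]
    simp only [Matrix.smul_mul, Matrix.mul_smul, smul_smul]
    congr 1
    push_cast
    ring
  rw [h4, absMoment_smul hH]
  congr 1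
  rcases (hp.1 x).eq_or_lt with h0 | h0
  · rw [← h0]
    simp [hα.ne']
  · rw [abs_of_pos (by positivity)]
    have : p x ^ r * p x * p x ^ r = p x ^ (1 / α) := by
      nth_rewrite 2 [← Real.rpow_one (p x)]
      rw [← Real.rpow_add h0, ← Real.rpow_add h0]
      congr 1
      rw [hr]
      field_simp
      ring
    rw [this, ← Real.rpow_mul h0.le, one_div_mul_cancel hα.ne', Real.rpow_one]

theorem relEntropyReal_cqState (hp : p ∈ stdSimplex ℝ X) (hρ : ∀ x, (ρ x).PosSemidef)
    (hσ : σ.PosSemidef) (h : ∀ x, p x ≠ 0 → SuppLE (ρ x) σ) :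
    relEntropyReal (cqState p ρ) (classicalState p ⊗ₖ σ) = ∑ x, p x * relEntropyReal (ρ x) σ := by
  rw [cqState_eq_block, classicalState_kronecker_eq_block, relEntropyReal_block
    (fun x => isHermitian_smul (hρ x).isHermitian _) (fun x => isHermitian_smul hσ.isHermitian _)]
  exact Finset.sum_congr rfl fun x _ => relEntropyReal_smul (hρ x) hσ (hp.1 x) (h x)

/-- The product of the marginals is the closest state of the form `p ⊗ σ`. -/
theorem relEntropyReal_outputState_le (hp : p ∈ stdSimplex ℝ X) (hρ : ∀ x, IsDensity (ρ x))
    (hσ : IsDensity σ) (h : ∀ x, p x ≠ 0 → SuppLE (ρ x) σ) :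
    relEntropyReal (cqState p ρ) (classicalState p ⊗ₖ outputState p ρ) ≤
      relEntropyReal (cqState p ρ) (classicalState p ⊗ₖ σ) := by
  have hB := isDensity_outputState hp hρ
  rw [relEntropyReal_cqState hp (fun x => (hρ x).1) hσ.1 h,
    relEntropyReal_cqState hp (fun x => (hρ x).1) hB.1 fun x hx => suppLE_outputState hp hρ hx,
    ← sub_nonneg]
  -- The difference of the two sides is exactly the relative entropy of `ρ_B` with respect to `σ`:
  -- the `log ρ x` terms cancel and the rest is linear in `ρ x`.
  have key := relEntropyReal_nonneg hB hσ (SuppLE.outputState h)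
  convert key using 1
  rw [← Finset.sum_sub_distrib, relEntropyReal]
  conv_rhs => rw [outputState, Matrix.sum_mul, Matrix.trace_sum, Complex.re_sum]
  refine Finset.sum_congr rfl fun x _ => ?_
  rw [Matrix.smul_mul, Matrix.trace_smul, smul_eq_mul, Complex.re_ofReal_mul, ← mul_sub,
    relEntropyReal, relEntropyReal, ← Complex.sub_re, ← Matrix.trace_sub, ← Matrix.mul_sub,
    sub_sub_sub_cancel_left]
  rfl

end ClassicalQuantumStates

/-! ### The covering exponent -/

section Exponent

variable {X d : Type*} [Fintype X] [DecidableEq X] [Fintype d] [DecidableEq d]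
  {p : X → ℝ} {ρ : X → Matrix d d ℂ}

theorem mutualInfo_eq (hp : p ∈ stdSimplex ℝ X) (hρ : ∀ x, IsDensity (ρ x)) :
    mutualInfo p ρ =
      (relEntropyReal (cqState p ρ) (classicalState p ⊗ₖ outputState p ρ) : ℝ) := by
  rw [mutualInfo, relativeEntropy, if_pos]
  · rfl
  · exact suppLE_cqState_iff.2 fun x hx => suppLE_outputState hp hρ hx

theorem sandwichedRenyiDiv_of_suppLE {A B : Matrix d d ℂ} {α : ℝ} (hα : 1 < α) (h : SuppLE A B) :
    sandwichedRenyiDiv α A B =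
      ((1 / (α - 1) * Real.log (sandwichedQ α A B) : ℝ) : EReal) := by
  rw [sandwichedRenyiDiv, if_neg]
  rintro (⟨-, h1⟩ | ⟨h1, -⟩)
  · exact h1 h
  · exact lt_asymm hα h1

theorem sandwichedRenyiDiv_of_not_suppLE {A B : Matrix d d ℂ} {α : ℝ} (hα : 1 < α)
    (h : ¬ SuppLE A B) : sandwichedRenyiDiv α A B = ⊤ := by
  rw [sandwichedRenyiDiv, if_pos (Or.inl ⟨hα, h⟩)]

/-- Only the existence of one good order is needed, so neither monotonicity in `α` nor a limit of
`I*_α` enters. From right to left, `ρ_B` is the witness for the infimum. -/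
theorem sandwichedRenyiInfo_lt_iff (hp : p ∈ stdSimplex ℝ X) (hρ : ∀ x, IsDensity (ρ x)) (R : ℝ) :
    (∃ α ∈ Set.Ioo (1 : ℝ) 2, sandwichedRenyiInfo α p ρ < (R : EReal)) ↔
      mutualInfo p ρ < (R : EReal) := by
  rw [mutualInfo_eq hp hρ, EReal.coe_lt_coe_iff]
  have hcq := isDensity_cqState hp hρ
  have hB := isDensity_outputState hp hρ
  have hsB : SuppLE (cqState p ρ) (classicalState p ⊗ₖ outputState p ρ) :=
    suppLE_cqState_iff.2 fun x hx => suppLE_outputState hp hρ hx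
  constructor
  · rintro ⟨α, hα, h⟩
    rw [sandwichedRenyiInfo, iInf_lt_iff] at h
    obtain ⟨σ, h⟩ := h
    rw [iInf_lt_iff] at h
    obtain ⟨hσ, h⟩ := h
    by_cases hs : SuppLE (cqState p ρ) (classicalState p ⊗ₖ σ)
    · rw [sandwichedRenyiDiv_of_suppLE hα.1 hs, EReal.coe_lt_coe_iff] at h
      exact ((relEntropyReal_outputState_le hp hρ hσ (suppLE_cqState_iff.1 hs)).trans
        (relEntropyReal_le hcq (posSemidef_classicalState_kronecker hp hσ.1) hs hα.1)).trans_lt h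
    · rw [sandwichedRenyiDiv_of_not_suppLE hα.1 hs] at h
      exact absurd h not_top_lt
  · intro h
    obtain ⟨α, hα, h1⟩ := exists_sandwichedQ_lt hcq
      (posSemidef_classicalState_kronecker hp hB.1) hsB h
    refine ⟨α, hα, lt_of_le_of_lt (iInf₂_le _ hB) ?_⟩
    rw [sandwichedRenyiDiv_of_suppLE hα.1 hsB, EReal.coe_lt_coe_iff]
    exact h1

theorem coe_mul_sub_pos_iff {c : ℝ} (hc : c < 0) (J : EReal) (R : ℝ) :
    0 < (c : EReal) * (J - (R : EReal)) ↔ J < (R : EReal) := by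
  induction J with
  | bot => simp [EReal.coe_mul_bot_of_neg hc]
  | top => simp [EReal.coe_mul_top_of_neg hc]
  | coe x =>
    rw [← EReal.coe_sub, ← EReal.coe_mul, EReal.coe_pos, EReal.coe_lt_coe_iff]
    exact ⟨fun h => sub_neg.1 (neg_of_mul_pos_right h hc.le),
      fun h => mul_pos_of_neg_of_neg hc (sub_neg.2 h)⟩

theorem coe_mul_sub_le {c : ℝ} (hc : c < 0) {J : EReal} {t : ℝ} (h : (t : EReal) ≤ J)
    (R : ℝ) : (c : EReal) * (J - (R : EReal)) ≤ ((c * (t - R) : ℝ) : EReal) := by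
  induction J with
  | bot => simp at h
  | top => simp [EReal.coe_mul_top_of_neg hc]
  | coe x =>
    rw [← EReal.coe_sub, ← EReal.coe_mul, EReal.coe_le_coe_iff]
    rw [EReal.coe_le_coe_iff] at h
    exact mul_le_mul_of_nonpos_left (by linarith) hc.le

theorem coveringExponent_pos_iff (hp : p ∈ stdSimplex ℝ X) (hρ : ∀ x, IsDensity (ρ x)) (R : ℝ) :
    0 < coveringExponent p ρ R ↔ mutualInfo p ρ < (R : EReal) := by
  rw [← sandwichedRenyiInfo_lt_iff hp hρ R, coveringExponent, lt_iSup_iff]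
  refine exists_congr fun α => ?_
  rw [lt_iSup_iff]
  constructor
  · rintro ⟨hα, h⟩
    have hc : (1 - α) / α < 0 := div_neg_of_neg_of_pos (by linarith [hα.1]) (by linarith [hα.1])
    exact ⟨hα, (coe_mul_sub_pos_iff hc _ R).1 h⟩
  · rintro ⟨hα, h⟩
    have hc : (1 - α) / α < 0 := div_neg_of_neg_of_pos (by linarith [hα.1]) (by linarith [hα.1])
    exact ⟨hα, (coe_mul_sub_pos_iff hc _ R).2 h⟩

/-- The logarithmic form lets each term of the supremum be compared with a real number, avoiding
extended-real exponentials until the end. -/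
theorem coveringExponent_le (hp : p ∈ stdSimplex ℝ X) (hρ : ∀ x, IsDensity (ρ x)) {n M : ℕ}
    {R : ℝ} (hn : 0 < n) (hM : 0 < M) (hR : R = 1 / (n : ℝ) * Real.log (M : ℝ))
    (hE : 0 < expectedTraceDistance M (productDist n p) (productChannel n ρ)
      (tensor fun _ : Fin n => outputState p ρ)) :
    coveringExponent p ρ R ≤ ((-(Real.log (expectedTraceDistance M (productDist n p)
      (productChannel n ρ) (tensor fun _ : Fin n => outputState p ρ))) / n : ℝ) : EReal) := by
  set E := expectedTraceDistance M (productDist n p) (productChannel n ρ)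
    (tensor fun _ : Fin n => outputState p ρ) with hEdef
  have hn0 : (0 : ℝ) < n := by exact_mod_cast hn
  have hM0 : (0 : ℝ) < M := by exact_mod_cast hM
  refine iSup₂_le fun α hα => ?_
  have hα0 : 0 < α := by linarith [hα.1]
  have hα1 : 0 < α - 1 := by linarith [hα.1]
  have hc : (1 - α) / α < 0 := div_neg_of_neg_of_pos (by linarith) hα0
  -- The fixed-`σ` bound solved for the divergence. Its left side is independent of `σ`, so it
  -- passes to the infimum; reference operators violating the support condition contribute `⊤`.
  have hbound : ((R + Real.log E * α / (n * (α - 1)) : ℝ) : EReal) ≤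
      sandwichedRenyiInfo α p ρ := by
    refine le_iInf₂ fun σ hσ => ?_
    by_cases hs : SuppLE (cqState p ρ) (classicalState p ⊗ₖ σ)
    · rw [sandwichedRenyiDiv_of_suppLE hα.1 hs, EReal.coe_le_coe_iff]
      have hQ := sandwichedQ_pos (isDensity_cqState hp hρ)
        (posSemidef_classicalState_kronecker hp hσ.1) hs hα.1
      have h1 := expectedTraceDistance_product_le (n := n) hp (fun x => (hρ x).1.isHermitian) hσ
        (suppLE_cqState_iff.1 hs) hα.1 hα.2.le hM
      rw [← sandwichedQ_cqState hp (fun x => (hρ x).1) hσ.1 hα0, ← hEdef] at h1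
      set Q := sandwichedQ α (cqState p ρ) (classicalState p ⊗ₖ σ)
      have h2 := Real.log_le_log hE h1
      rw [Real.log_rpow (by positivity), Real.log_mul (by positivity) (by positivity),
        Real.log_rpow hM0, Real.log_pow] at h2
      have hlM : Real.log M = n * R := by rw [hR]; field_simp
      rw [hlM] at h2
      have h3 : Real.log E * α ≤ (1 - α) * (n * R) + n * Real.log Q := by
        calc Real.log E * α ≤ 1 / α * ((1 - α) * (n * R) + n * Real.log Q) * α :=
              mul_le_mul_of_nonneg_right h2 hα0.le
          _ = _ := by field_simp
      have h4 : Real.log E * α / (n * (α - 1)) ≤ 1 / (α - 1) * Real.log Q - R := by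
        rw [div_le_iff₀ (by positivity)]
        refine h3.trans_eq ?_
        have := hα1.ne'
        field_simp
        ring
      linarith
    · rw [sandwichedRenyiDiv_of_not_suppLE hα.1 hs]
      exact le_top
  refine (coe_mul_sub_le hc hbound R).trans (le_of_eq ?_)
  congr 1
  have := hα1.ne'
  field_simp
  ring

theorem ofReal_expectedTraceDistance_le (hp : p ∈ stdSimplex ℝ X) (hρ : ∀ x, IsDensity (ρ x))
    {n M : ℕ} {R : ℝ} (hn : 0 < n) (hM : 0 < M) (hR : R = 1 / (n : ℝ) * Real.log (M : ℝ)) :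
    ENNReal.ofReal (expectedTraceDistance M (productDist n p) (productChannel n ρ)
        (tensor fun _ : Fin n => outputState p ρ)) ≤
      EReal.exp (-(((n : ℝ) : EReal) * coveringExponent p ρ R)) := by
  -- The logarithmic bound needs a positive expected distance; otherwise `ENNReal.ofReal` returns
  -- `0`.
  rcases le_or_gt (expectedTraceDistance M (productDist n p) (productChannel n ρ)
    (tensor fun _ : Fin n => outputState p ρ)) 0 with hE | hE
  · rw [ENNReal.ofReal_of_nonpos hE]
    exact zero_le
  · have h := coveringExponent_le hp hρ hn hM hR hE
    set E := expectedTraceDistance M (productDist n p) (productChannel n ρ)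
      (tensor fun _ : Fin n => outputState p ρ)
    have hn0 : (0 : ℝ) < n := by exact_mod_cast hn
    have h1 : ((n : ℝ) : EReal) * coveringExponent p ρ R ≤ ((-Real.log E : ℝ) : EReal) := by
      have h2 := mul_le_mul_of_nonneg_left h (EReal.coe_nonneg.2 hn0.le)
      rw [← EReal.coe_mul, mul_div_cancel₀ _ hn0.ne'] at h2
      exact h2
    have h3 : ((Real.log E : ℝ) : EReal) ≤ -(((n : ℝ) : EReal) * coveringExponent p ρ R) := by
      rw [EReal.le_neg, ← EReal.coe_neg]
      exact h1
    have h4 := EReal.exp_monotone h3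
    rwa [EReal.exp_coe, Real.exp_log hE] at h4

end Exponent

end SoftCovering

end

/-- Soft covering with a random i.i.d. codebook of `M` codewords of length `n` and rate
`R = (1 / n) log M`. -/
theorem mainTheorem3 {X d : Type*} [Fintype X] [DecidableEq X] [Fintype d] [DecidableEq d]
    (p : X → ℝ) (hp : p ∈ stdSimplex ℝ X)
    (ρ : X → Matrix d d ℂ) (hρ : ∀ x, SoftCovering.IsDensity (ρ x)) :
    (∀ (n M : ℕ) (R : ℝ), 0 < n → 0 < M → R = 1 / (n : ℝ) * Real.log (M : ℝ) →
      ENNReal.ofReal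
          (SoftCovering.expectedTraceDistance M (SoftCovering.productDist n p)
            (SoftCovering.productChannel n ρ)
            (SoftCovering.tensor fun _ : Fin n => SoftCovering.outputState p ρ)) ≤
        EReal.exp (-(((n : ℝ) : EReal) * SoftCovering.coveringExponent p ρ R))) ∧
    (∀ R : ℝ, 0 < SoftCovering.coveringExponent p ρ R ↔
      SoftCovering.mutualInfo p ρ < (R : EReal)) :=
  ⟨fun _ _ _ hn hM hR => SoftCovering.ofReal_expectedTraceDistance_le hp hρ hn hM hR,
    SoftCovering.coveringExponent_pos_iff hp hρ⟩
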